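/- **Definitions.** A topological groupoid is a groupoid whose objects and arrows form topological spaces and whose structure maps are continuous. An orbifold $\mathcal{X}$ of dimension $d$ is a topological groupoid with object space $\mathcal{X}_0$ and arrow space $\mathcal{X}_1$ such that $\mathcal{X}_0$ and $\mathcal{X}_1$ are smooth (Hausdorff) $d$-manifolds, the source and target maps $s,t:\mathcal{X}_1\to\mathcal{X}_0$ are local diffeomorphisms, the map $(s,t):\mathcal{X}_1\to\mathcal{X}_0\times\mathcal{X}_0$ is proper, and the coarse space $|\mathcal{X}|=\mathcal{X}_0/(x\sim y\text{ if there is an arrow }x\to y)$ is paracompact and Hausdorff. A point $x\in\mathcal{X}_0$ is an orbifold point if its isotropy group $\{g\in\mathcal{X}_1: s(g)=t(g)=x\}$ is non-trivial. The classifying space $B\mathcal{G}$ of a topological groupoid $\mathcal{G}$ is the geometric realisation of its nerve (a simplicial space). For $n\ge 0$, $\mathrm{Conf}_n(\mathcal{X})$ is the topological groupoid whose objects are the unordered configurations of $n$ points, with object space $$\{(x_1,\dots,x_n)\in\mathcal{X}_0^{\,n} : \text{there is no arrow } x_i\to x_j \text{ in } \mathcal{X}_1 \text{ for } i\ne j\}/\Sigma_n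 ,$$ and in which an arrow $\{x_1,\dots,x_n\}\to\{x_1',\dots,x_n'\}$ is an unordered collection of $n$ arrows of $\mathcal{X}$ such that each $x_i$ is the source of exactly one and each $x_j'$ is the target of exactly one of them (topologised as a quotient, by $\Sigma_n$, of a subspace of $\mathcal{X}_1^{\,n}$). For $i\ge 0$, $\mathrm{Conf}_n(\mathcal{X})_i$ is the topological groupoid whose objects are the tuples $(\underline{x},p_0,\dots,p_i)$ with $\underline{x}\in \mathrm{Conf}_n(\mathcal{X})$, with $p_0,\dots,p_i\in\mathcal{X}_0$ not orbifold points, and with $\underline{x}\cup\{p_0,\dots,p_i\}\in\mathrm{Conf}_{n+i+1}(\mathcal{X})$; an arrow $(\underline{x},p_0,\dots,p_i)\to(\underline{x}',p_0',\dots,p_i')$ consists of an arrow $\underline{x}\to\underline{x}'$ of $\mathrm{Conf}_n(\mathcal{X})$ and arrows $p_j\to p_j'$ of $\mathcal{X}$ for all $j$. The $j$-th face map forgets $p_j$. Applying $B$ gives a semisimplicial space $B\mathrm{Conf}_n(\mathcal{X})_\bullet$; write $\|B\mathrm{Conf}_n(\mathcal{X})_\bullet\|$ for its geometric realisation. Forgetting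 all the $p_j$ induces the augmentation map $$\varphi:\|B\mathrm{Conf}_n(\mathcal{X})_\bullet\|\to B\mathrm{Conf}_n(\mathcal{X}).$$ **Lemma.** Let $\mathcal{X}$ be an orbifold of dimension $d\ge 1$ that has at least one point which is not an orbifold point, and let $n\ge 0$. Then $\varphi$ is a weak homotopy equivalence, i.e. it induces a bijection on path components and bijections $\pi_m(\|B\mathrm{Conf}_n(\mathcal{X})_\bullet\|,a)\to\pi_m(B\mathrm{Conf}_n(\mathcal{X}),\varphi(a))$ for all $m\ge1$ and all base points $a$. -/

import Mathlib

open CategoryTheory Opposite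
open scoped Manifold ContDiff Topology Simplicial Topology.Homotopy

universe u

/-! ### Topological groupoids -/

/-- A topological groupoid: a groupoid whose objects and arrows form topological spaces and whose
structure maps are continuous. `comp f g` is the composite "first `f`, then `g`". -/
structure TopGroupoid where
  /-- The space of objects. -/
  Ob : Type u
  /-- The space of arrows. -/
  Ar : Type u
  [topOb : TopologicalSpace Ob]
  [topAr : TopologicalSpace Ar]
  /-- The source map. -/
  src : Ar → Ob
  /-- The target map. -/
  tgt : Ar → Ob
  /-- The identity arrows. -/
  one : Ob → Ar
  /-- The inverse arrows. -/
  inv : Ar → Ar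
  /-- Composition of composable arrows. -/
  comp : (f g : Ar) → tgt f = src g → Ar
  src_one : ∀ x, src (one x) = x
  tgt_one : ∀ x, tgt (one x) = x
  src_inv : ∀ f, src (inv f) = tgt f
  tgt_inv : ∀ f, tgt (inv f) = src f
  src_comp : ∀ f g h, src (comp f g h) = src f
  tgt_comp : ∀ f g h, tgt (comp f g h) = tgt g
  one_comp : ∀ f, comp (one (src f)) f (tgt_one _) = f
  comp_one : ∀ f, comp f (one (tgt f)) (src_one _).symm = f
  assoc : ∀ f g k (hfg : tgt f = src g) (hgk : tgt g = src k),
    comp (comp f g hfg) k ((tgt_comp f g hfg).trans hgk) =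
      comp f (comp g k hgk) (hfg.trans (src_comp g k hgk).symm)
  comp_inv : ∀ f, comp f (inv f) (src_inv f).symm = one (src f)
  inv_comp : ∀ f, comp (inv f) f (tgt_inv f) = one (tgt f)
  continuous_src : Continuous src
  continuous_tgt : Continuous tgt
  continuous_one : Continuous one
  continuous_inv : Continuous inv
  continuous_comp : Continuous
    fun p : {p : Ar × Ar // tgt p.1 = src p.2} => comp p.1.1 p.1.2 p.2

namespace TopGroupoid

attribute [instance] topOb topAr

/-- There is an arrow `x → y`. -/
def Linked (G : TopGroupoid.{u}) (x y : G.Ob) : Prop :=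
  ∃ g : G.Ar, G.src g = x ∧ G.tgt g = y

/-- The underlying set of the isotropy group of `x`: all arrows `x → x`. -/
def Isotropy (G : TopGroupoid.{u}) (x : G.Ob) : Type u :=
  {g : G.Ar // G.src g = x ∧ G.tgt g = x}

/-- An orbifold point is a point with non-trivial isotropy group. -/
def IsOrbifoldPoint (G : TopGroupoid.{u}) (x : G.Ob) : Prop :=
  Nontrivial (G.Isotropy x)

/-- Composites are determined by the arrows. -/
theorem comp_congr (G : TopGroupoid.{u}) {f f' g g' : G.Ar} (hf : f = f') (hg : g = g')
    (h : G.tgt f = G.src g) : G.comp f g h = G.comp f' g' (hf ▸ hg ▸ h) := by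
  subst hf; subst hg; rfl

theorem linked_refl (G : TopGroupoid.{u}) (x : G.Ob) : G.Linked x x :=
  ⟨G.one x, G.src_one x, G.tgt_one x⟩

theorem linked_symm (G : TopGroupoid.{u}) {x y : G.Ob} (h : G.Linked x y) : G.Linked y x := by
  obtain ⟨g, rfl, rfl⟩ := h
  exact ⟨G.inv g, G.src_inv g, G.tgt_inv g⟩

theorem linked_trans (G : TopGroupoid.{u}) {x y z : G.Ob} (h : G.Linked x y)
    (h' : G.Linked y z) : G.Linked x z := by
  obtain ⟨g, rfl, hg⟩ := h
  obtain ⟨g', hg', rfl⟩ := h'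
  exact ⟨G.comp g g' (hg.trans hg'.symm), G.src_comp _ _ _, G.tgt_comp _ _ _⟩

theorem linked_src_tgt (G : TopGroupoid.{u}) (g : G.Ar) : G.Linked (G.src g) (G.tgt g) :=
  ⟨g, rfl, rfl⟩

/-- `x ∼ y` when there is an arrow `x → y`. -/
def setoid (G : TopGroupoid.{u}) : Setoid G.Ob where
  r := G.Linked
  iseqv := ⟨G.linked_refl, G.linked_symm, G.linked_trans⟩

/-- The coarse space `|G|`, with the quotient topology. -/
abbrev Coarse (G : TopGroupoid.{u}) : Type u := Quotient G.setoid

/-! ### The category of topological groupoids -/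

/-- A continuous functor between topological groupoids. -/
@[ext]
structure Hom (G H : TopGroupoid.{u}) where
  /-- The map on objects. -/
  ob : G.Ob → H.Ob
  /-- The map on arrows. -/
  ar : G.Ar → H.Ar
  src_ar : ∀ f, H.src (ar f) = ob (G.src f)
  tgt_ar : ∀ f, H.tgt (ar f) = ob (G.tgt f)
  ar_one : ∀ x, ar (G.one x) = H.one (ob x)
  ar_comp : ∀ f g (h : G.tgt f = G.src g),
    ar (G.comp f g h) = H.comp (ar f) (ar g) (by rw [tgt_ar, src_ar, h])
  continuous_ob : Continuous ob
  continuous_ar : Continuous ar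

instance : Category TopGroupoid.{u} where
  Hom := Hom
  id G :=
    { ob := id
      ar := id
      src_ar := fun _ => rfl
      tgt_ar := fun _ => rfl
      ar_one := fun _ => rfl
      ar_comp := fun _ _ _ => rfl
      continuous_ob := continuous_id
      continuous_ar := continuous_id }
  comp F F' :=
    { ob := fun x => F'.ob (F.ob x)
      ar := fun f => F'.ar (F.ar f)
      src_ar := fun f => by rw [F'.src_ar, F.src_ar]
      tgt_ar := fun f => by rw [F'.tgt_ar, F.tgt_ar]
      ar_one := fun x => by rw [F.ar_one, F'.ar_one]
      ar_comp := fun f g h => by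
        rw [← F'.ar_comp, F.ar_comp]
      continuous_ob := F'.continuous_ob.comp F.continuous_ob
      continuous_ar := F'.continuous_ar.comp F.continuous_ar }

/-! ### The nerve and the classifying space -/

/-- A `k`-simplex of the nerve of `G`: a functor from the ordered set `{0 < ⋯ < k}` to `G`
(equivalently, a chain of `k` composable arrows). -/
@[ext]
structure NerveSimplex (G : TopGroupoid.{u}) (k : ℕ) where
  /-- The objects of the chain. -/
  ob : Fin (k + 1) → G.Ob
  /-- The arrows between the objects of the chain. -/
  ar : ∀ i j : Fin (k + 1), i ≤ j → G.Ar
  src_ar : ∀ i j h, G.src (ar i j h) = ob i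
  tgt_ar : ∀ i j h, G.tgt (ar i j h) = ob j
  ar_refl : ∀ i, ar i i le_rfl = G.one (ob i)
  ar_trans : ∀ i j l (hij : i ≤ j) (hjl : j ≤ l),
    ar i l (hij.trans hjl) = G.comp (ar i j hij) (ar j l hjl) (by rw [tgt_ar, src_ar])

/-- The space of `k`-simplices has the subspace topology from the spaces of objects and arrows:
the coarsest topology for which all objects and arrows of the chain depend continuously on it. -/
instance (G : TopGroupoid.{u}) (k : ℕ) : TopologicalSpace (G.NerveSimplex k) :=
  (⨅ i, TopologicalSpace.induced (fun γ => γ.ob i) G.topOb) ⊓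
    ⨅ (i) (j) (h), TopologicalSpace.induced (fun γ => γ.ar i j h) G.topAr

theorem continuous_nerve_ob (G : TopGroupoid.{u}) {k : ℕ} (i : Fin (k + 1)) :
    Continuous fun γ : G.NerveSimplex k => γ.ob i :=
  continuous_iff_le_induced.2 (inf_le_left.trans (iInf_le _ i))

theorem continuous_nerve_ar (G : TopGroupoid.{u}) {k : ℕ} (i j : Fin (k + 1)) (h : i ≤ j) :
    Continuous fun γ : G.NerveSimplex k => γ.ar i j h :=
  continuous_iff_le_induced.2
    (inf_le_right.trans ((iInf_le _ i).trans ((iInf_le _ j).trans (iInf_le _ h))))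

theorem continuous_nerve_iff (G : TopGroupoid.{u}) {k : ℕ} {Z : Type*} [TopologicalSpace Z]
    {f : Z → G.NerveSimplex k} (hob : ∀ i, Continuous fun z => (f z).ob i)
    (har : ∀ i j h, Continuous fun z => (f z).ar i j h) : Continuous f :=
  continuous_inf_rng.2 ⟨continuous_iInf_rng.2 fun i => continuous_induced_rng.2 (hob i),
    continuous_iInf_rng.2 fun i => continuous_iInf_rng.2 fun j => continuous_iInf_rng.2 fun h =>
      continuous_induced_rng.2 (har i j h)⟩

/-- The simplicial operator of the nerve given by a monotone map `θ`. -/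
def NerveSimplex.reindex {G : TopGroupoid.{u}} {k m : ℕ} (θ : Fin (k + 1) →o Fin (m + 1))
    (γ : G.NerveSimplex m) : G.NerveSimplex k where
  ob i := γ.ob (θ i)
  ar i j h := γ.ar (θ i) (θ j) (θ.monotone h)
  src_ar _ _ _ := γ.src_ar _ _ _
  tgt_ar _ _ _ := γ.tgt_ar _ _ _
  ar_refl _ := γ.ar_refl _
  ar_trans _ _ _ _ _ := γ.ar_trans _ _ _ _ _

theorem NerveSimplex.continuous_reindex {G : TopGroupoid.{u}} {k m : ℕ}
    (θ : Fin (k + 1) →o Fin (m + 1)) :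
    Continuous (NerveSimplex.reindex θ : G.NerveSimplex m → G.NerveSimplex k) :=
  continuous_nerve_iff _ (fun _ => continuous_nerve_ob _ _) fun _ _ _ => continuous_nerve_ar _ _ _ _

/-- The map induced on `k`-simplices of the nerve by a continuous functor. -/
def NerveSimplex.map {G H : TopGroupoid.{u}} (F : G ⟶ H) {k : ℕ}
    (γ : G.NerveSimplex k) : H.NerveSimplex k where
  ob i := Hom.ob F (γ.ob i)
  ar i j h := Hom.ar F (γ.ar i j h)
  src_ar i j h := by rw [Hom.src_ar, γ.src_ar]
  tgt_ar i j h := by rw [Hom.tgt_ar, γ.tgt_ar]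
  ar_refl i := by rw [γ.ar_refl, Hom.ar_one]
  ar_trans i j l hij hjl := by rw [γ.ar_trans i j l hij hjl, Hom.ar_comp]

theorem NerveSimplex.continuous_map {G H : TopGroupoid.{u}} (F : G ⟶ H) (k : ℕ) :
    Continuous (NerveSimplex.map F : G.NerveSimplex k → H.NerveSimplex k) :=
  continuous_nerve_iff _ (fun _ => (Hom.continuous_ob F).comp (continuous_nerve_ob _ _))
    fun _ _ _ => (Hom.continuous_ar F).comp (continuous_nerve_ar _ _ _ _)

/-- The nerve of a topological groupoid, as a simplicial space. -/
def nerve : TopGroupoid.{u} ⥤ SimplicialObject TopCat.{u} where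
  obj G :=
    { obj := fun k => TopCat.of (G.NerveSimplex k.unop.len)
      map := fun θ => TopCat.ofHom
        ⟨NerveSimplex.reindex θ.unop.toOrderHom, NerveSimplex.continuous_reindex _⟩
      map_id := fun _ => rfl
      map_comp := fun _ _ => rfl }
  map F :=
    { app := fun k => TopCat.ofHom
        ⟨NerveSimplex.map F, NerveSimplex.continuous_map F k.unop.len⟩
      naturality := fun _ _ _ => rfl }
  map_id _ := rfl
  map_comp _ _ := rfl

end TopGroupoid

/-- The gluing relation `(θ^* y, t) ∼ (y, θ_* t)` on `∐ₖ Yₖ × Δᵏ`, for all monotone maps `θ`. -/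
inductive RealizationRel (Y : SimplicialObject TopCat.{u}) :
    (Σ k : ℕ, Y.obj (op ⦋k⦌) × stdSimplex ℝ (Fin (k + 1))) →
      (Σ k : ℕ, Y.obj (op ⦋k⦌) × stdSimplex ℝ (Fin (k + 1))) → Prop where
  | glue {k m : ℕ} (θ : ⦋k⦌ ⟶ ⦋m⦌) (y : Y.obj (op ⦋m⦌)) (t : stdSimplex ℝ (Fin (k + 1))) :
      RealizationRel Y ⟨k, Y.map θ.op y, t⟩ ⟨m, y, stdSimplex.map θ.toOrderHom t⟩

/-- The geometric realisation of a simplicial space: the quotient space of `∐ₖ Yₖ × Δᵏ` by the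
equivalence relation generated by the gluing relation. -/
def realization : SimplicialObject TopCat.{u} ⥤ TopCat.{u} where
  obj Y := TopCat.of (Quot (RealizationRel Y))
  map {Y Z} F := TopCat.ofHom
    ⟨Quot.map (fun p => ⟨p.1, F.app (op ⦋p.1⦌) p.2.1, p.2.2⟩) (by
        rintro _ _ ⟨θ, y, t⟩
        have h : F.app _ (Y.map θ.op y) = Z.map θ.op (F.app _ y) :=
          ConcreteCategory.congr_hom (F.naturality θ.op) y
        dsimp only
        rw [h]
        exact RealizationRel.glue θ _ t),
      by
        refine continuous_quot_lift _ (continuous_quot_mk.comp ?_)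
        refine continuous_sigma fun k => continuous_sigmaMk.comp ?_
        exact ((F.app (op ⦋k⦌)).hom.continuous.comp continuous_fst).prodMk continuous_snd⟩
  map_id Y := by
    ext x
    obtain ⟨x, rfl⟩ := Quot.exists_rep x
    rfl
  map_comp F G := by
    ext x
    obtain ⟨x, rfl⟩ := Quot.exists_rep x
    rfl

/-- The classifying space `BG` of a topological groupoid: the geometric realisation of its
nerve. -/
def TopGroupoid.classifyingSpace : TopGroupoid.{u} ⥤ TopCat.{u} :=
  TopGroupoid.nerve ⋙ realization

/-! ### Semisimplicial spaces -/

/-- The gluing relation `(θ^* y, t) ∼ (y, θ_* t)` on `∐ᵢ Yᵢ × Δⁱ`, for all injective monotone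
maps `θ`. -/
inductive FatRealizationRel (Y : SemiSimplexCategoryᵒᵖ ⥤ TopCat.{u}) :
    (Σ i : ℕ, Y.obj (op ⦋i⦌ₛ) × stdSimplex ℝ (Fin (i + 1))) →
      (Σ i : ℕ, Y.obj (op ⦋i⦌ₛ) × stdSimplex ℝ (Fin (i + 1))) → Prop where
  | glue {i j : ℕ} (θ : ⦋i⦌ₛ ⟶ ⦋j⦌ₛ) (y : Y.obj (op ⦋j⦌ₛ)) (t : stdSimplex ℝ (Fin (i + 1))) :
      FatRealizationRel Y ⟨i, Y.map θ.op y, t⟩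
        ⟨j, y, stdSimplex.map (SemiSimplexCategory.homEquiv θ) t⟩

/-- The geometric realisation `‖Y‖` of a semisimplicial space. -/
def fatRealization (Y : SemiSimplexCategoryᵒᵖ ⥤ TopCat.{u}) : TopCat.{u} :=
  TopCat.of (Quot (FatRealizationRel Y))

/-- The map `‖Y‖ → T` induced by an augmentation `ε : Y → T`; it sends the class of `(y, t)`
to `ε y`. -/
def fatRealizationDesc {Y : SemiSimplexCategoryᵒᵖ ⥤ TopCat.{u}} {T : TopCat.{u}}
    (ε : Y ⟶ (Functor.const _).obj T) : C(fatRealization Y, T) :=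
  ⟨Quot.lift (fun p => ε.app (op ⦋p.1⦌ₛ) p.2.1) (by
      rintro _ _ ⟨θ, y, t⟩
      exact ConcreteCategory.congr_hom (ε.naturality θ.op) y),
    by
      refine continuous_quot_lift _ (continuous_sigma fun i => ?_)
      exact (ε.app (op ⦋i⦌ₛ)).hom.continuous.comp continuous_fst⟩

/-! ### Weak homotopy equivalences -/

/-- The map `π₀(A) → π₀(B)` induced by a continuous map. -/
def zerothHomotopyMap {A B : Type*} [TopologicalSpace A] [TopologicalSpace B] (f : C(A, B)) :
    ZerothHomotopy A → ZerothHomotopy B :=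
  Quotient.map f fun _ _ h => h.map f.continuous

/-- The map `π_N(A, a) → π_N(B, f(a))` induced by a continuous map. -/
def homotopyGroupMap {A B : Type*} [TopologicalSpace A] [TopologicalSpace B] (N : Type*)
    (f : C(A, B)) (a : A) : HomotopyGroup N A a → HomotopyGroup N B (f a) :=
  Quotient.map (fun γ => ⟨f.comp γ.1, fun y hy => congrArg f (γ.2 y hy)⟩)
    fun _ _ h => h.comp_continuousMap f

/-- A weak homotopy equivalence: a continuous map inducing a bijection on path components and on
all homotopy groups at all base points. -/
def IsWeakHomotopyEquiv {A B : Type*} [TopologicalSpace A] [TopologicalSpace B]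
    (f : C(A, B)) : Prop :=
  Function.Bijective (zerothHomotopyMap f) ∧
    ∀ m : ℕ, 1 ≤ m → ∀ a : A, Function.Bijective (homotopyGroupMap (Fin m) f a)

/-! ### Orbifolds -/

/-- A `d`-dimensional orbifold: a proper topological groupoid whose object and arrow spaces are
smooth Hausdorff `d`-manifolds, whose source and target maps are local diffeomorphisms, and whose
coarse space is paracompact Hausdorff. (As source and target are local diffeomorphisms, the
continuous unit, inversion and composition maps are automatically smooth.) -/
structure Orbifold (d : ℕ) extends TopGroupoid.{u} where
  [t2Ob : T2Space Ob]
  [t2Ar : T2Space Ar]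
  [chartedOb : ChartedSpace (EuclideanSpace ℝ (Fin d)) Ob]
  [chartedAr : ChartedSpace (EuclideanSpace ℝ (Fin d)) Ar]
  [manifoldOb : IsManifold (𝓡 d) ∞ Ob]
  [manifoldAr : IsManifold (𝓡 d) ∞ Ar]
  isLocalDiffeomorph_src : IsLocalDiffeomorph (𝓡 d) (𝓡 d) ∞ src
  isLocalDiffeomorph_tgt : IsLocalDiffeomorph (𝓡 d) (𝓡 d) ∞ tgt
  isProperMap_src_tgt : IsProperMap fun g : Ar => (src g, tgt g)
  t2Coarse : T2Space toTopGroupoid.Coarse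
  paracompactCoarse : ParacompactSpace toTopGroupoid.Coarse

attribute [instance] Orbifold.t2Ob Orbifold.t2Ar Orbifold.chartedOb Orbifold.chartedAr
  Orbifold.manifoldOb Orbifold.manifoldAr

namespace TopGroupoid

/-! ### Products, powers and full subgroupoids -/

/-- The product of two topological groupoids. -/
def prod (G H : TopGroupoid.{u}) : TopGroupoid.{u} where
  Ob := G.Ob × H.Ob
  Ar := G.Ar × H.Ar
  src f := (G.src f.1, H.src f.2)
  tgt f := (G.tgt f.1, H.tgt f.2)
  one x := (G.one x.1, H.one x.2)
  inv f := (G.inv f.1, H.inv f.2)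
  comp f g h := (G.comp f.1 g.1 (congrArg Prod.fst h), H.comp f.2 g.2 (congrArg Prod.snd h))
  src_one x := Prod.ext (G.src_one _) (H.src_one _)
  tgt_one x := Prod.ext (G.tgt_one _) (H.tgt_one _)
  src_inv f := Prod.ext (G.src_inv _) (H.src_inv _)
  tgt_inv f := Prod.ext (G.tgt_inv _) (H.tgt_inv _)
  src_comp f g h := Prod.ext (G.src_comp _ _ _) (H.src_comp _ _ _)
  tgt_comp f g h := Prod.ext (G.tgt_comp _ _ _) (H.tgt_comp _ _ _)
  one_comp f := Prod.ext (G.one_comp _) (H.one_comp _)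
  comp_one f := Prod.ext (G.comp_one _) (H.comp_one _)
  assoc f g k hfg hgk := Prod.ext (G.assoc _ _ _ (congrArg Prod.fst hfg) (congrArg Prod.fst hgk))
    (H.assoc _ _ _ (congrArg Prod.snd hfg) (congrArg Prod.snd hgk))
  comp_inv f := Prod.ext (G.comp_inv _) (H.comp_inv _)
  inv_comp f := Prod.ext (G.inv_comp _) (H.inv_comp _)
  continuous_src := G.continuous_src.prodMap H.continuous_src
  continuous_tgt := G.continuous_tgt.prodMap H.continuous_tgt
  continuous_one := G.continuous_one.prodMap H.continuous_one
  continuous_inv := G.continuous_inv.prodMap H.continuous_inv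
  continuous_comp := by
    refine Continuous.prodMk ?_ ?_
    · exact G.continuous_comp.comp (Continuous.subtype_mk
        (f := fun p : {p : (G.Ar × H.Ar) × (G.Ar × H.Ar) //
          (G.tgt p.1.1, H.tgt p.1.2) = (G.src p.2.1, H.src p.2.2)} => (p.1.1.1, p.1.2.1))
        (by fun_prop) fun p => congrArg Prod.fst p.2)
    · exact H.continuous_comp.comp (Continuous.subtype_mk
        (f := fun p : {p : (G.Ar × H.Ar) × (G.Ar × H.Ar) //
          (G.tgt p.1.1, H.tgt p.1.2) = (G.src p.2.1, H.src p.2.2)} => (p.1.1.2, p.1.2.2))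
        (by fun_prop) fun p => congrArg Prod.snd p.2)

/-- The power `G^ι` of a topological groupoid. -/
def pow (G : TopGroupoid.{u}) (ι : Type) : TopGroupoid.{u} where
  Ob := ι → G.Ob
  Ar := ι → G.Ar
  src f i := G.src (f i)
  tgt f i := G.tgt (f i)
  one x i := G.one (x i)
  inv f i := G.inv (f i)
  comp f g h i := G.comp (f i) (g i) (congrFun h i)
  src_one x := funext fun i => G.src_one _
  tgt_one x := funext fun i => G.tgt_one _
  src_inv f := funext fun i => G.src_inv _
  tgt_inv f := funext fun i => G.tgt_inv _
  src_comp f g h := funext fun i => G.src_comp _ _ _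
  tgt_comp f g h := funext fun i => G.tgt_comp _ _ _
  one_comp f := funext fun i => G.one_comp _
  comp_one f := funext fun i => G.comp_one _
  assoc f g k hfg hgk := funext fun i => G.assoc _ _ _ (congrFun hfg i) (congrFun hgk i)
  comp_inv f := funext fun i => G.comp_inv _
  inv_comp f := funext fun i => G.inv_comp _
  continuous_src := continuous_pi fun i => G.continuous_src.comp (continuous_apply i)
  continuous_tgt := continuous_pi fun i => G.continuous_tgt.comp (continuous_apply i)
  continuous_one := continuous_pi fun i => G.continuous_one.comp (continuous_apply i)
  continuous_inv := continuous_pi fun i => G.continuous_inv.comp (continuous_apply i)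
  continuous_comp := continuous_pi fun i => G.continuous_comp.comp (Continuous.subtype_mk
    (f := fun p : {p : (ι → G.Ar) × (ι → G.Ar) //
      (fun i => G.tgt (p.1 i)) = fun i => G.src (p.2 i)} => (p.1.1 i, p.1.2 i))
    (by fun_prop) fun p => congrFun p.2 i)

/-- The full subgroupoid on the objects satisfying `P`, with the subspace topologies. -/
def full (G : TopGroupoid.{u}) (P : G.Ob → Prop) : TopGroupoid.{u} where
  Ob := {x : G.Ob // P x}
  Ar := {f : G.Ar // P (G.src f) ∧ P (G.tgt f)}
  src f := ⟨G.src f.1, f.2.1⟩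
  tgt f := ⟨G.tgt f.1, f.2.2⟩
  one x := ⟨G.one x.1, by rw [G.src_one]; exact x.2, by rw [G.tgt_one]; exact x.2⟩
  inv f := ⟨G.inv f.1, by rw [G.src_inv]; exact f.2.2, by rw [G.tgt_inv]; exact f.2.1⟩
  comp f g h := ⟨G.comp f.1 g.1 (congrArg Subtype.val h),
    by rw [G.src_comp]; exact f.2.1, by rw [G.tgt_comp]; exact g.2.2⟩
  src_one x := Subtype.ext (G.src_one _)
  tgt_one x := Subtype.ext (G.tgt_one _)
  src_inv f := Subtype.ext (G.src_inv _)
  tgt_inv f := Subtype.ext (G.tgt_inv _)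
  src_comp f g h := Subtype.ext (G.src_comp _ _ _)
  tgt_comp f g h := Subtype.ext (G.tgt_comp _ _ _)
  one_comp f := Subtype.ext (G.one_comp _)
  comp_one f := Subtype.ext (G.comp_one _)
  assoc f g k hfg hgk := Subtype.ext
    (G.assoc _ _ _ (congrArg Subtype.val hfg) (congrArg Subtype.val hgk))
  comp_inv f := Subtype.ext (G.comp_inv _)
  inv_comp f := Subtype.ext (G.inv_comp _)
  continuous_src := (G.continuous_src.comp continuous_subtype_val).subtype_mk _
  continuous_tgt := (G.continuous_tgt.comp continuous_subtype_val).subtype_mk _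
  continuous_one := (G.continuous_one.comp continuous_subtype_val).subtype_mk _
  continuous_inv := (G.continuous_inv.comp continuous_subtype_val).subtype_mk _
  continuous_comp := by
    refine Continuous.subtype_mk ?_ _
    exact G.continuous_comp.comp (Continuous.subtype_mk
        (f := fun p : {p : {f : G.Ar // P (G.src f) ∧ P (G.tgt f)} ×
            {f : G.Ar // P (G.src f) ∧ P (G.tgt f)} //
          (⟨G.tgt p.1.1, p.1.2.2⟩ : {x : G.Ob // P x}) = ⟨G.src p.2.1, p.2.2.1⟩} =>
            (p.1.1.1, p.1.2.1))
        (by fun_prop) fun p => congrArg Subtype.val p.2)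

/-! ### Configurations -/

/-- `S` is a configuration of `n` points: it has exactly `n` elements, and there are no arrows
between distinct elements of `S`. -/
def IsConfig (G : TopGroupoid.{u}) (n : ℕ) (S : Set G.Ob) : Prop :=
  S.encard = n ∧ S.Pairwise fun x y => ¬ G.Linked x y

/-- Ordered configurations of `n` points, as a subspace of the `n`-fold product. -/
abbrev OrdConf (G : TopGroupoid.{u}) (n : ℕ) : Type u :=
  {x : Fin n → G.Ob // Pairwise fun i j => ¬ G.Linked (x i) (x j)}

/-- Unordered configurations of `n` points. -/
def ConfOb (G : TopGroupoid.{u}) (n : ℕ) : Type u := {S : Set G.Ob // G.IsConfig n S}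

/-- Ordered `n`-tuples of arrows whose sources form an ordered configuration. -/
abbrev OrdConfAr (G : TopGroupoid.{u}) (n : ℕ) : Type u :=
  {α : Fin n → G.Ar // Pairwise fun i j => ¬ G.Linked (G.src (α i)) (G.src (α j))}

/-- Unordered `n`-tuples of arrows whose sources form a configuration of `n` points (then so do
their targets). -/
def ConfAr (G : TopGroupoid.{u}) (n : ℕ) : Type u :=
  {A : Set G.Ar // A.encard = n ∧ A.Pairwise fun f g => ¬ G.Linked (G.src f) (G.src g)}

section
variable {G : TopGroupoid.{u}} {n : ℕ}

theorem OrdConf.injective (x : G.OrdConf n) : Function.Injective x.1 := by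
  intro i j h
  by_contra hij
  exact x.2 hij (h ▸ G.linked_refl _)

theorem linked_tgt_iff (f g : G.Ar) :
    G.Linked (G.tgt f) (G.tgt g) ↔ G.Linked (G.src f) (G.src g) :=
  ⟨fun h => G.linked_trans (G.linked_src_tgt f) (G.linked_trans h (G.linked_symm
    (G.linked_src_tgt g))), fun h => G.linked_trans (G.linked_symm (G.linked_src_tgt f))
    (G.linked_trans h (G.linked_src_tgt g))⟩

theorem OrdConfAr.injective (α : G.OrdConfAr n) : Function.Injective α.1 := by
  intro i j h
  by_contra hij
  exact α.2 hij (h ▸ G.linked_refl _)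

theorem encard_range {T : Type*} {x : Fin n → T} (hx : Function.Injective x) :
    (Set.range x).encard = n := by
  rw [← Set.image_univ, hx.encard_image, Set.encard_univ]
  simp

theorem exists_range_eq {T : Type*} {S : Set T} (hS : S.encard = n) :
    ∃ x : Fin n → T, Function.Injective x ∧ Set.range x = S := by
  have hf : S.Finite := Set.finite_of_encard_eq_coe hS
  have : Fintype S := hf.fintype
  have hc : Fintype.card S = n := by
    rw [← Set.toFinset_card, ← ENat.natCast_inj, ← Set.encard_eq_coe_toFinset_card, hS]
  let e : Fin n ≃ S := (Fintype.equivFinOfCardEq hc).symm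
  exact ⟨fun i => (e i : T), Subtype.val_injective.comp e.injective, by
    rw [show (fun i => (e i : T)) = Subtype.val ∘ e from rfl, e.surjective.range_comp]; simp⟩

/-- Two injective enumerations of the same set differ by a permutation. -/
theorem exists_perm {T : Type*} {x y : Fin n → T} (hx : Function.Injective x)
    (hy : Function.Injective y) (h : Set.range x = Set.range y) :
    ∃ σ : Equiv.Perm (Fin n), ∀ i, y (σ i) = x i := by
  refine ⟨(Equiv.ofInjective x hx).trans ((Equiv.setCongr h).trans (Equiv.ofInjective y hy).symm),
    fun i => ?_⟩
  have := Equiv.apply_ofInjective_symm hy ((Equiv.setCongr h) (Equiv.ofInjective x hx i))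
  simpa using this

/-- The configuration underlying an ordered configuration. -/
def OrdConf.forget (x : G.OrdConf n) : G.ConfOb n :=
  ⟨Set.range x.1, encard_range x.injective, by
    rintro _ ⟨i, rfl⟩ _ ⟨j, rfl⟩ h
    exact x.2 fun hij => h (hij ▸ rfl)⟩

/-- The unordered tuple underlying an ordered tuple of arrows. -/
def OrdConfAr.forget (α : G.OrdConfAr n) : G.ConfAr n :=
  ⟨Set.range α.1, encard_range α.injective, by
    rintro _ ⟨i, rfl⟩ _ ⟨j, rfl⟩ h
    exact α.2 fun hij => h (hij ▸ rfl)⟩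

/-- The quotient topology from ordered configurations, by the action of the symmetric group. -/
instance : TopologicalSpace (G.ConfOb n) := TopologicalSpace.coinduced OrdConf.forget inferInstance

/-- The quotient topology from ordered tuples, by the action of the symmetric group. -/
instance : TopologicalSpace (G.ConfAr n) :=
  TopologicalSpace.coinduced OrdConfAr.forget inferInstance

theorem OrdConf.forget_surjective : Function.Surjective (OrdConf.forget : G.OrdConf n → _) := by
  rintro ⟨S, hS, hp⟩
  obtain ⟨x, hx, rfl⟩ := exists_range_eq hS
  exact ⟨⟨x, fun i j hij => hp ⟨i, rfl⟩ ⟨j, rfl⟩ (hx.ne hij)⟩, rfl⟩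

theorem OrdConfAr.forget_surjective :
    Function.Surjective (OrdConfAr.forget : G.OrdConfAr n → _) := by
  rintro ⟨S, hS, hp⟩
  obtain ⟨x, hx, rfl⟩ := exists_range_eq hS
  exact ⟨⟨x, fun i j hij => hp ⟨i, rfl⟩ ⟨j, rfl⟩ (hx.ne hij)⟩, rfl⟩

theorem OrdConf.isQuotientMap_forget :
    Topology.IsQuotientMap (OrdConf.forget : G.OrdConf n → _) :=
  ⟨⟨rfl⟩, OrdConf.forget_surjective⟩

theorem OrdConfAr.isOpenQuotientMap_forget :
    IsOpenQuotientMap (OrdConfAr.forget : G.OrdConfAr n → _) := by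
  have hq : Topology.IsQuotientMap (OrdConfAr.forget : G.OrdConfAr n → _) :=
    ⟨⟨rfl⟩, OrdConfAr.forget_surjective⟩
  refine ⟨OrdConfAr.forget_surjective, hq.continuous, fun U hU => ?_⟩
  rw [← hq.isOpen_preimage]
  let act (σ : Equiv.Perm (Fin n)) (α : G.OrdConfAr n) : G.OrdConfAr n :=
    ⟨fun i => α.1 (σ i), fun i j hij => α.2 (σ.injective.ne hij)⟩
  have hact : ∀ σ, Continuous (act σ) := fun σ => by
    have : Continuous fun (α : G.OrdConfAr n) i => α.1 (σ i) :=
      continuous_pi fun i => (continuous_apply (σ i)).comp continuous_subtype_val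
    exact this.subtype_mk _
  have : OrdConfAr.forget ⁻¹' (OrdConfAr.forget '' U) = ⋃ σ, act σ ⁻¹' U := by
    ext α
    simp only [Set.mem_preimage, Set.mem_image, Set.mem_iUnion]
    constructor
    · rintro ⟨β, hβ, h⟩
      obtain ⟨σ, hσ⟩ := exists_perm β.injective α.injective (congrArg Subtype.val h)
      exact ⟨σ, by rwa [show act σ α = β from Subtype.ext (funext hσ)]⟩
    · rintro ⟨σ, hσ⟩
      exact ⟨act σ α, hσ, Subtype.ext (σ.surjective.range_comp α.1)⟩
  rw [this]
  exact isOpen_iUnion fun σ => hU.preimage (hact σ)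

/-- An `n`-tuple of arrows starts at a configuration. -/
def ConfAr.src (A : G.ConfAr n) : G.ConfOb n :=
  ⟨G.src '' A.1, by
    rw [Set.InjOn.encard_image, A.2.1]
    intro f hf g hg h
    by_contra hfg
    exact A.2.2 hf hg hfg (h ▸ G.linked_refl _), by
    rintro _ ⟨f, hf, rfl⟩ _ ⟨g, hg, rfl⟩ h
    exact A.2.2 hf hg fun hfg => h (hfg ▸ rfl)⟩

theorem ConfAr.tgt_injOn (A : G.ConfAr n) : Set.InjOn G.tgt A.1 := by
  intro f hf g hg h
  by_contra hfg
  exact A.2.2 hf hg hfg ((linked_tgt_iff f g).1 (h ▸ G.linked_refl _))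

theorem ConfAr.src_injOn (A : G.ConfAr n) : Set.InjOn G.src A.1 := by
  intro f hf g hg h
  by_contra hfg
  exact A.2.2 hf hg hfg (h ▸ G.linked_refl _)

/-- An `n`-tuple of arrows ends at a configuration. -/
def ConfAr.tgt (A : G.ConfAr n) : G.ConfOb n :=
  ⟨G.tgt '' A.1, by rw [A.tgt_injOn.encard_image, A.2.1], by
    rintro _ ⟨f, hf, rfl⟩ _ ⟨g, hg, rfl⟩ h
    rw [linked_tgt_iff]
    exact A.2.2 hf hg fun hfg => h (hfg ▸ rfl)⟩

/-- The identity arrow of a configuration consists of the identity arrows of its points. -/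
def ConfOb.one (S : G.ConfOb n) : G.ConfAr n :=
  ⟨G.one '' S.1, by
    rw [Set.InjOn.encard_image, S.2.1]
    intro x _ y _ h
    rw [← G.src_one x, h, G.src_one], by
    rintro _ ⟨x, hx, rfl⟩ _ ⟨y, hy, rfl⟩ h
    rw [G.src_one, G.src_one]
    exact S.2.2 hx hy fun hxy => h (hxy ▸ rfl)⟩

/-- The inverse of a tuple of arrows consists of the inverse arrows. -/
def ConfAr.inv (A : G.ConfAr n) : G.ConfAr n :=
  ⟨G.inv '' A.1, by
    rw [Set.InjOn.encard_image, A.2.1]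
    intro f hf g hg h
    exact A.tgt_injOn hf hg (by rw [← G.src_inv f, h, G.src_inv]), by
    rintro _ ⟨f, hf, rfl⟩ _ ⟨g, hg, rfl⟩ h
    rw [G.src_inv, G.src_inv, linked_tgt_iff]
    exact A.2.2 hf hg fun hfg => h (hfg ▸ rfl)⟩

/-- The set of all composites of an arrow in `A` with an arrow in `B`. -/
def compSet (A B : Set G.Ar) : Set G.Ar :=
  {f | ∃ a ∈ A, ∃ b ∈ B, ∃ h : G.tgt a = G.src b, f = G.comp a b h}

/-- Composition of ordered tuples of arrows, entry by entry, after reordering the second tuple. -/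
def OrdConfAr.comp (α β : G.OrdConfAr n) (σ : Equiv.Perm (Fin n))
    (h : ∀ i, G.tgt (α.1 i) = G.src (β.1 (σ i))) : G.OrdConfAr n :=
  ⟨fun i => G.comp (α.1 i) (β.1 (σ i)) (h i), fun i j hij => by
    simpa only [G.src_comp] using α.2 hij⟩

theorem OrdConfAr.compSet_range (α β : G.OrdConfAr n) (σ : Equiv.Perm (Fin n))
    (h : ∀ i, G.tgt (α.1 i) = G.src (β.1 (σ i))) :
    compSet (Set.range α.1) (Set.range β.1) = Set.range (α.comp β σ h).1 := by
  ext f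
  constructor
  · rintro ⟨_, ⟨i, rfl⟩, _, ⟨j, rfl⟩, hij, rfl⟩
    have : σ i = j := by
      by_contra hne
      exact β.2 hne (by rw [← h i, hij]; exact G.linked_refl _)
    subst this
    exact ⟨i, rfl⟩
  · rintro ⟨i, rfl⟩
    exact ⟨_, ⟨i, rfl⟩, _, ⟨σ i, rfl⟩, h i, rfl⟩

theorem OrdConfAr.exists_perm_of_tgt_eq_src (α β : G.OrdConfAr n)
    (h : α.forget.tgt = β.forget.src) :
    ∃ σ : Equiv.Perm (Fin n), ∀ i, G.tgt (α.1 i) = G.src (β.1 (σ i)) := by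
  have h' : G.tgt '' Set.range α.1 = G.src '' Set.range β.1 := congrArg Subtype.val h
  rw [← Set.range_comp, ← Set.range_comp] at h'
  obtain ⟨σ, hσ⟩ := exists_perm (x := G.tgt ∘ α.1) (y := G.src ∘ β.1)
    (fun i j hij => α.injective (α.forget.tgt_injOn ⟨i, rfl⟩ ⟨j, rfl⟩ hij))
    (fun i j hij => β.injective (β.forget.src_injOn ⟨i, rfl⟩ ⟨j, rfl⟩ hij)) h'
  exact ⟨σ, fun i => (hσ i).symm⟩

/-- Composition of unordered tuples of arrows: all composites of composable arrows. -/
def ConfAr.comp (A B : G.ConfAr n) (h : A.tgt = B.src) : G.ConfAr n :=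
  ⟨compSet A.1 B.1, by
    obtain ⟨α, rfl⟩ := OrdConfAr.forget_surjective A
    obtain ⟨β, rfl⟩ := OrdConfAr.forget_surjective B
    obtain ⟨σ, hσ⟩ := α.exists_perm_of_tgt_eq_src β h
    have := (α.comp β σ hσ).forget.2
    change (Set.range (α.comp β σ hσ).1).encard = n ∧ (Set.range _).Pairwise _ at this
    rw [← α.compSet_range β σ hσ] at this
    exact this⟩

theorem ConfAr.continuous_comp [T2Space G.Ob] : Continuous
    fun p : {p : G.ConfAr n × G.ConfAr n // p.1.tgt = p.2.src} => p.1.1.comp p.1.2 p.2 := by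
  have hq : IsOpenQuotientMap (OrdConfAr.forget : G.OrdConfAr n → _) :=
    OrdConfAr.isOpenQuotientMap_forget
  have hQ := (hq.prodMap hq).restrictPreimage
    (Set.ofPred fun p : G.ConfAr n × G.ConfAr n => p.1.tgt = p.2.src)
  refine hQ.continuous_comp_iff.1 ?_
  let P : Type u := (Prod.map OrdConfAr.forget OrdConfAr.forget ⁻¹'
    (Set.ofPred fun p : G.ConfAr n × G.ConfAr n => p.1.tgt = p.2.src) : Set (G.OrdConfAr n × G.OrdConfAr n))
  let C (σ : Equiv.Perm (Fin n)) : Set P :=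
    {p | ∀ i, G.tgt (p.1.1.1 i) = G.src (p.1.2.1 (σ i))}
  have h1 : ∀ i, Continuous fun p : P => p.1.1.1 i := fun i =>
    (continuous_apply i).comp (continuous_subtype_val.comp
      (continuous_fst.comp continuous_subtype_val))
  have h2 : ∀ i, Continuous fun p : P => p.1.2.1 i := fun i =>
    (continuous_apply i).comp (continuous_subtype_val.comp
      (continuous_snd.comp continuous_subtype_val))
  refine LocallyFinite.continuous (f := C) (locallyFinite_of_finite C) ?_ ?_ ?_
  · refine Set.eq_univ_of_forall fun p => Set.mem_iUnion.2 ?_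
    exact p.1.1.exists_perm_of_tgt_eq_src p.1.2 p.2
  · intro σ
    have : C σ = ⋂ i, {p | G.tgt (p.1.1.1 i) = G.src (p.1.2.1 (σ i))} := by
      ext p; simp [C]
    rw [this]
    exact isClosed_iInter fun i => isClosed_eq (G.continuous_tgt.comp (h1 i))
      (G.continuous_src.comp (h2 (σ i)))
  · intro σ
    rw [continuousOn_iff_continuous_domRestrict]
    have hc : Continuous fun p : C σ => (p.1.1.1.comp p.1.1.2 σ p.2).forget := by
      refine hq.continuous.comp (Continuous.subtype_mk (continuous_pi fun i => ?_) _)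
      exact G.continuous_comp.comp (Continuous.subtype_mk
        (f := fun p : C σ => (p.1.1.1.1 i, p.1.1.2.1 (σ i)))
        (((h1 i).comp continuous_subtype_val).prodMk ((h2 (σ i)).comp continuous_subtype_val))
        fun p => p.2 i)
    convert hc using 2 with p
    exact Subtype.ext (OrdConfAr.compSet_range _ _ σ p.2)

end

/-- The configuration groupoid of `n` unordered points: objects are the unordered configurations
of `n` points, and an arrow `S → S'` is an unordered collection of `n` arrows such that each point
of `S` is the source of exactly one of them and each point of `S'` the target of exactly one. -/
def conf (G : TopGroupoid.{u}) [T2Space G.Ob] (n : ℕ) : TopGroupoid.{u} where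
  Ob := G.ConfOb n
  Ar := G.ConfAr n
  src := ConfAr.src
  tgt := ConfAr.tgt
  one := ConfOb.one
  inv := ConfAr.inv
  comp := ConfAr.comp
  src_one S := Subtype.ext (by simp [ConfAr.src, ConfOb.one, Set.image_image, G.src_one])
  tgt_one S := Subtype.ext (by simp [ConfAr.tgt, ConfOb.one, Set.image_image, G.tgt_one])
  src_inv A := Subtype.ext (by
    simp [ConfAr.src, ConfAr.tgt, ConfAr.inv, Set.image_image, G.src_inv])
  tgt_inv A := Subtype.ext (by
    simp [ConfAr.src, ConfAr.tgt, ConfAr.inv, Set.image_image, G.tgt_inv])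
  src_comp A B h := Subtype.ext (by
    ext x
    constructor
    · rintro ⟨_, ⟨a, ha, b, hb, hab, rfl⟩, rfl⟩
      exact ⟨a, ha, (G.src_comp _ _ _).symm⟩
    · rintro ⟨a, ha, rfl⟩
      obtain ⟨b, hb, hab⟩ := (congrArg Subtype.val h).subset ⟨a, ha, rfl⟩
      exact ⟨_, ⟨a, ha, b, hb, hab.symm, rfl⟩, G.src_comp _ _ _⟩)
  tgt_comp A B h := Subtype.ext (by
    ext x
    constructor
    · rintro ⟨_, ⟨a, ha, b, hb, hab, rfl⟩, rfl⟩
      exact ⟨b, hb, (G.tgt_comp _ _ _).symm⟩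
    · rintro ⟨b, hb, rfl⟩
      obtain ⟨a, ha, hab⟩ := (congrArg Subtype.val h).symm.subset ⟨b, hb, rfl⟩
      exact ⟨_, ⟨a, ha, b, hb, hab, rfl⟩, G.tgt_comp _ _ _⟩)
  one_comp A := Subtype.ext (by
    ext f
    constructor
    · rintro ⟨_, ⟨_, ⟨a, ha, rfl⟩, rfl⟩, b, hb, hab, rfl⟩
      have : G.src a = G.src b := by rw [← hab, G.tgt_one]
      obtain rfl := A.src_injOn ha hb this
      rwa [G.one_comp]
    · intro hf
      exact ⟨_, ⟨_, ⟨f, hf, rfl⟩, rfl⟩, f, hf, G.tgt_one _, (G.one_comp f).symm⟩)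
  comp_one A := Subtype.ext (by
    ext f
    constructor
    · rintro ⟨b, hb, _, ⟨_, ⟨a, ha, rfl⟩, rfl⟩, hab, rfl⟩
      have : G.tgt a = G.tgt b := by rw [hab, G.src_one]
      obtain rfl := A.tgt_injOn ha hb this
      rwa [G.comp_one]
    · intro hf
      exact ⟨f, hf, _, ⟨_, ⟨f, hf, rfl⟩, rfl⟩, (G.src_one _).symm, (G.comp_one f).symm⟩)
  assoc A B C hAB hBC := Subtype.ext (by
    ext f
    constructor
    · rintro ⟨_, ⟨a, ha, b, hb, hab, rfl⟩, c, hc, h, rfl⟩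
      have hbc : G.tgt b = G.src c := by rw [← h, G.tgt_comp]
      exact ⟨a, ha, _, ⟨b, hb, c, hc, hbc, rfl⟩, by rw [G.src_comp, hab], G.assoc _ _ _ hab hbc⟩
    · rintro ⟨a, ha, _, ⟨b, hb, c, hc, hbc, rfl⟩, h, rfl⟩
      have hab : G.tgt a = G.src b := by rw [h, G.src_comp]
      exact ⟨_, ⟨a, ha, b, hb, hab, rfl⟩, c, hc, by rw [G.tgt_comp, hbc],
        (G.assoc _ _ _ hab hbc).symm⟩)
  comp_inv A := Subtype.ext (by
    ext f
    constructor
    · rintro ⟨a, ha, _, ⟨b, hb, rfl⟩, hab, rfl⟩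
      obtain rfl := A.tgt_injOn ha hb (by rw [hab, G.src_inv])
      exact ⟨_, ⟨a, ha, rfl⟩, (G.comp_inv a).symm⟩
    · rintro ⟨_, ⟨a, ha, rfl⟩, rfl⟩
      exact ⟨a, ha, _, ⟨a, ha, rfl⟩, (G.src_inv a).symm, (G.comp_inv a).symm⟩)
  inv_comp A := Subtype.ext (by
    ext f
    constructor
    · rintro ⟨_, ⟨b, hb, rfl⟩, a, ha, hab, rfl⟩
      obtain rfl := A.src_injOn hb ha (by rw [← hab, G.tgt_inv])
      exact ⟨_, ⟨b, hb, rfl⟩, (G.inv_comp b).symm⟩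
    · rintro ⟨_, ⟨a, ha, rfl⟩, rfl⟩
      exact ⟨_, ⟨a, ha, rfl⟩, a, ha, G.tgt_inv a, (G.inv_comp a).symm⟩)
  continuous_src := by
    refine OrdConfAr.isOpenQuotientMap_forget.continuous_comp_iff.1 ?_
    have : (ConfAr.src ∘ OrdConfAr.forget : G.OrdConfAr n → _) =
        OrdConf.forget ∘ fun α => ⟨fun i => G.src (α.1 i), α.2⟩ :=
      funext fun α => Subtype.ext (Set.range_comp G.src α.1).symm
    rw [this]
    exact OrdConf.isQuotientMap_forget.continuous.comp (Continuous.subtype_mk (continuous_pi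
      fun i => G.continuous_src.comp ((continuous_apply i).comp continuous_subtype_val)) _)
  continuous_tgt := by
    refine OrdConfAr.isOpenQuotientMap_forget.continuous_comp_iff.1 ?_
    have : (ConfAr.tgt ∘ OrdConfAr.forget : G.OrdConfAr n → _) =
        OrdConf.forget ∘ fun α => ⟨fun i => G.tgt (α.1 i), fun i j hij => by
          simpa only [linked_tgt_iff] using α.2 hij⟩ :=
      funext fun α => Subtype.ext (Set.range_comp G.tgt α.1).symm
    rw [this]
    exact OrdConf.isQuotientMap_forget.continuous.comp (Continuous.subtype_mk (continuous_pi
      fun i => G.continuous_tgt.comp ((continuous_apply i).comp continuous_subtype_val)) _)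
  continuous_one := by
    refine OrdConf.isQuotientMap_forget.continuous_iff.2 ?_
    have : (ConfOb.one ∘ OrdConf.forget : G.OrdConf n → _) =
        OrdConfAr.forget ∘ fun x => ⟨fun i => G.one (x.1 i), fun i j hij => by
          simpa only [G.src_one] using x.2 hij⟩ :=
      funext fun x => Subtype.ext (Set.range_comp G.one x.1).symm
    rw [this]
    exact OrdConfAr.isOpenQuotientMap_forget.continuous.comp (Continuous.subtype_mk (continuous_pi
      fun i => G.continuous_one.comp ((continuous_apply i).comp continuous_subtype_val)) _)
  continuous_inv := by
    refine OrdConfAr.isOpenQuotientMap_forget.continuous_comp_iff.1 ?_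
    have : (ConfAr.inv ∘ OrdConfAr.forget : G.OrdConfAr n → _) =
        OrdConfAr.forget ∘ fun α => ⟨fun i => G.inv (α.1 i), fun i j hij => by
          simpa only [G.src_inv, linked_tgt_iff] using α.2 hij⟩ :=
      funext fun α => Subtype.ext (Set.range_comp G.inv α.1).symm
    rw [this]
    exact OrdConfAr.isOpenQuotientMap_forget.continuous.comp (Continuous.subtype_mk (continuous_pi
      fun i => G.continuous_inv.comp ((continuous_apply i).comp continuous_subtype_val)) _)
  continuous_comp := ConfAr.continuous_comp

/-! ### The semisimplicial resolution of a configuration groupoid -/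

/-- `(S, p₀, …, pᵢ)` is admissible when `S ∪ {p₀, …, pᵢ}` is a configuration of `n + i + 1`
points and no `pⱼ` is an orbifold point. -/
def IsResolutionOb (G : TopGroupoid.{u}) [T2Space G.Ob] (n i : ℕ)
    (x : ((G.conf n).prod (G.pow (Fin (i + 1)))).Ob) : Prop :=
  G.IsConfig (n + (i + 1)) (x.1.1 ∪ Set.range x.2) ∧ ∀ j, ¬ G.IsOrbifoldPoint (x.2 j)

/-- The groupoid of configurations `S` of `n` points together with `i + 1` extra ordered
non-orbifold points; arrows consist of an arrow of configurations of `n` points and an ordered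
`(i + 1)`-tuple of arrows between the extra points. -/
def confResolution (G : TopGroupoid.{u}) [T2Space G.Ob] (n i : ℕ) : TopGroupoid.{u} :=
  ((G.conf n).prod (G.pow (Fin (i + 1)))).full (G.IsResolutionOb n i)

theorem IsResolutionOb.comp {G : TopGroupoid.{u}} [T2Space G.Ob] {n i j : ℕ}
    {x : ((G.conf n).prod (G.pow (Fin (j + 1)))).Ob} (h : G.IsResolutionOb n j x)
    (θ : Fin (i + 1) ↪o Fin (j + 1)) : G.IsResolutionOb n i (x.1, fun l => x.2 (θ l)) := by
  obtain ⟨⟨S, hS, hS'⟩, (p : Fin (j + 1) → G.Ob)⟩ := x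
  obtain ⟨⟨hc, hp⟩, ho⟩ := h
  change (S ∪ Set.range p).encard = _ at hc
  change (S ∪ Set.range p).Pairwise _ at hp
  have hsub : S ∪ Set.range (fun l => p (θ l)) ⊆ S ∪ Set.range p :=
    Set.union_subset_union_right S (by rintro _ ⟨l, rfl⟩; exact ⟨θ l, rfl⟩)
  refine ⟨⟨?_, hp.mono hsub⟩, fun l => ho (θ l)⟩
  change (S ∪ Set.range (fun l => p (θ l))).encard = _
  classical
  obtain ⟨x, hx, rfl⟩ := exists_range_eq hS
  have hinj : Function.Injective (Sum.elim x p) := by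
    rw [← Set.Sum.elim_range] at hc
    have hcard : (Finset.univ.image (Sum.elim x p)).card = Fintype.card (Fin n ⊕ Fin (j + 1)) := by
      rw [← ENat.natCast_inj, ← Set.encard_coe_eq_coe_finsetCard]
      simpa using hc
    have := Finset.card_image_iff.1 hcard
    rwa [Finset.coe_univ, Set.injOn_univ] at this
  rw [← Set.Sum.elim_range, show Sum.elim x (fun l => p (θ l)) =
    Sum.elim x p ∘ Sum.map id θ by ext (a | a) <;> rfl, ← Set.image_univ,
    (hinj.comp (Function.injective_id.sumMap θ.injective)).encard_image, Set.encard_univ]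
  simp

/-- The continuous functor `(S, p) ↦ (S, p ∘ θ)`. -/
def confFace (G : TopGroupoid.{u}) [T2Space G.Ob] (n : ℕ) {i j : ℕ}
    (θ : Fin (i + 1) ↪o Fin (j + 1)) : G.confResolution n j ⟶ G.confResolution n i :=
  Hom.mk (G := G.confResolution n j) (H := G.confResolution n i)
    (fun x => ⟨(x.1.1, fun l => x.1.2 (θ l)), x.2.comp θ⟩)
    (fun f => ⟨(f.1.1, fun l => f.1.2 (θ l)), f.2.1.comp θ, f.2.2.comp θ⟩)
    (fun _ => rfl) (fun _ => rfl) (fun _ => rfl) (fun _ _ _ => rfl)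
    (by
      refine Continuous.subtype_mk (Continuous.prodMk ?_ (continuous_pi fun l => ?_)) _
      · exact continuous_fst.comp continuous_subtype_val
      · exact (continuous_apply (θ l)).comp (continuous_snd.comp continuous_subtype_val))
    (by
      refine Continuous.subtype_mk (Continuous.prodMk ?_ (continuous_pi fun l => ?_)) _
      · exact continuous_fst.comp continuous_subtype_val
      · exact (continuous_apply (θ l)).comp (continuous_snd.comp continuous_subtype_val))

/-- The continuous functor `(S, p) ↦ S`. -/
def confForget (G : TopGroupoid.{u}) [T2Space G.Ob] (n i : ℕ) :
    G.confResolution n i ⟶ G.conf n :=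
  Hom.mk (G := G.confResolution n i) (H := G.conf n) (fun x => x.1.1) (fun f => f.1.1)
    (fun _ => rfl) (fun _ => rfl) (fun _ => rfl) (fun _ _ _ => rfl)
    (continuous_fst.comp continuous_subtype_val) (continuous_fst.comp continuous_subtype_val)

/-- The semisimplicial topological groupoid of configurations of `n` points with extra ordered
non-orbifold points: an injective monotone map `θ` sends `(S, p)` to `(S, p ∘ θ)`. In particular
the `j`-th face map forgets `pⱼ`. -/
def confSemisimplicial (G : TopGroupoid.{u}) [T2Space G.Ob] (n : ℕ) :
    SemiSimplexCategoryᵒᵖ ⥤ TopGroupoid.{u} where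
  obj i := G.confResolution n i.unop.len
  map θ := G.confFace n (SemiSimplexCategory.homEquiv θ.unop)
  map_id i := by
    rw [unop_id, SemiSimplexCategory.homEquiv_id]
    rfl
  map_comp θ θ' := by
    rw [unop_comp, SemiSimplexCategory.homEquiv_comp]
    rfl

/-- The semisimplicial space `i ↦ B Conf_n(G)_i`. -/
def classifyingConfSemisimplicial (G : TopGroupoid.{u}) [T2Space G.Ob] (n : ℕ) :
    SemiSimplexCategoryᵒᵖ ⥤ TopCat.{u} :=
  G.confSemisimplicial n ⋙ classifyingSpace

/-- The augmentation map `‖B Conf_n(G)_•‖ → B Conf_n(G)`, induced by forgetting all the extra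
points. -/
def confAugmentation (G : TopGroupoid.{u}) [T2Space G.Ob] (n : ℕ) :
    C(fatRealization (G.classifyingConfSemisimplicial n), classifyingSpace.obj (G.conf n)) :=
  fatRealizationDesc (T := classifyingSpace.obj (G.conf n))
    { app := fun i => classifyingSpace.map (G.confForget n i.unop.len)
      naturality := fun _ j θ =>
        (classifyingSpace.map_comp ((G.confSemisimplicial n).map θ)
          (G.confForget n j.unop.len)).symm.trans (Category.comp_id _).symm }

end TopGroupoid

/-! The augmentation has a section, and the composite "augmentation, then section" is homotopic to
the identity through maps over the base. Such a map is a weak homotopy equivalence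
(`isWeakHomotopyEquiv_of_section`), so no fibration or quasi-fibration argument is needed.

A point of the resolution over the class of `(γ, t)` is a finite weighted family of chains in `G`,
ordered, pairwise unlinked, unlinked to the configurations of `γ`, and never at orbifold points. If
one extra point avoided every configuration and every extra point, the fibres could be coned off
with it. No single point does so; a sequence of non-orbifold points `w.pt a` with suitable cut-offs
replaces it. Near a non-orbifold point the only arrows are identities and, since `d ≥ 1`, there is
room for infinitely many disjoint open sets. Their images in the coarse space are open and disjoint,
and Urysohn functions there give invariant functions `w.bump a` which vanish near the orbit of `w.pt
a` and have pairwise disjoint zero sets.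

The section puts at `w.pt a` a weight proportional to the product of `w.bump a` over the
configuration. This product vanishes as soon as the configuration comes near `w.pt a`. As `n` points
lie in at most `n` of the zero sets, one of the first `n + 1` weights is positive.

The homotopy shrinks the old weights `s l` to `max 0 (s l - 2 τ M)`, with `M` the largest of them,
so that all have vanished at `τ = 1/2`; the new weights are switched on after `τ = 1/4`. While old
and new points coexist, a surviving old point has `s l > M / 2`. A new point therefore has to avoid
only the old points with `3 s l ≥ M`, of which there are at most `3 / M`. The pigeonhole argument
still finds an admissible new point among about `n + 3 / M` candidates. Since `M` is not bounded
below over all simplices, an infinite sequence of points is needed. After `τ = 3/4` the avoidance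
condition is relaxed, and at `τ = 1` the weights are those of the section.

All formulas use only invariant functions and are insensitive to coordinates equal to zero, hence
respect both gluing relations. For continuity, every parameter must have a neighbourhood on which
the weights are carried by one finite family that is free at that parameter
(`continuous_weightedPoint`). Freeness is then open because the relation "linked" is closed, by
properness of `(s, t)`. -/

/-! ### Fibrewise deformation retractions are weak homotopy equivalences -/

section CubeShrinking

open scoped unitInterval

variable {m : ℕ}

/-- The linear homotopy from the identity of the cube to the map which expands the inner half of
the cube to the whole cube and collapses the outer shell to the boundary. -/
noncomputable def cubeExpand (τ : I) (y : Fin m → I) : Fin m → I :=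
  -- At `τ = 1` each coordinate is `2 y - 1/2` clamped to the unit interval, so `[1/4, 3/4]` is
  -- stretched onto `[0, 1]`.
  fun i => Set.projIcc 0 1 zero_le_one ((y i : ℝ) + τ * (y i - 1 / 2))

/-- A function on the cube which vanishes on the boundary, and is `1` on the inner half. -/
noncomputable def cubeDepth (y : Fin m → I) : I :=
  -- The quadratic takes the value `-2` at `0` and `1`, and the value `1` at `1/4` and `3/4`; the
  -- clamped factor is `1` exactly on `[1/4, 3/4]`.
  ∏ i, Set.projIcc 0 1 zero_le_one (16 * ((y i : ℝ) * (1 - y i)) - 2 : ℝ)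

theorem continuous_cubeExpand : Continuous fun p : I × (Fin m → I) => cubeExpand p.1 p.2 := by
  refine continuous_pi fun i => continuous_projIcc.comp ?_
  fun_prop

theorem continuous_cubeDepth : Continuous (cubeDepth : (Fin m → I) → I) := by
  refine continuous_finsetProd _ fun i _ => continuous_projIcc.comp ?_
  fun_prop

theorem cubeExpand_zero (y : Fin m → I) : cubeExpand 0 y = y := by
  funext i
  simp [cubeExpand]

theorem cubeExpand_mem_boundary (τ : I) {y : Fin m → I} (hy : y ∈ Cube.boundary (Fin m)) :
    cubeExpand τ y ∈ Cube.boundary (Fin m) := by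
  obtain ⟨i, h | h⟩ := hy
  · refine ⟨i, Or.inl (Set.projIcc_of_le_left _ ?_)⟩
    have := τ.2.1
    rw [h]; simpa using this
  · refine ⟨i, Or.inr (Set.projIcc_of_right_le _ ?_)⟩
    have := τ.2.1
    rw [h]; simp only [Set.Icc.coe_one]; nlinarith

theorem cubeDepth_eq_zero {y : Fin m → I} (hy : y ∈ Cube.boundary (Fin m)) : cubeDepth y = 0 := by
  obtain ⟨i, h⟩ := hy
  refine Finset.prod_eq_zero (Finset.mem_univ i) (Set.projIcc_of_le_left _ ?_)
  rcases h with h | h <;> rw [h] <;> norm_num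

/-- If no coordinate is clamped by `cubeExpand 1`, then all lie strictly between `1/4` and `3/4`,
where every factor of the depth is `1`. The two alternatives are the closed pieces on which maps are
glued below. -/
theorem cubeDepth_eq_one_or (y : Fin m → I) :
    cubeDepth y = 1 ∨ cubeExpand 1 y ∈ Cube.boundary (Fin m) := by
  by_cases h : cubeExpand 1 y ∈ Cube.boundary (Fin m)
  · exact Or.inr h
  refine Or.inl (Finset.prod_eq_one fun i _ => Set.projIcc_of_right_le _ ?_)
  have h0 : 1 / 4 < (y i : ℝ) := by
    by_contra h0
    refine h ⟨i, Or.inl (Set.projIcc_of_le_left _ ?_)⟩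
    simp only [Set.Icc.coe_one]; linarith
  have h1 : (y i : ℝ) < 3 / 4 := by
    by_contra h1
    refine h ⟨i, Or.inr (Set.projIcc_of_right_le _ ?_)⟩
    simp only [Set.Icc.coe_one]; linarith
  nlinarith

variable {A B : Type*} [TopologicalSpace A] [TopologicalSpace B]

/-- The generalised loop obtained from a loop `γ` by a homotopy of maps `A → A` starting at the
identity, using the track of the base point on the outer shell of the cube. -/
noncomputable def slideLoop (H : C(I × A, A)) (H0 : ∀ a, H (0, a) = a) (τ : I) {a : A}
    (γ : GenLoop (Fin m) A a) : GenLoop (Fin m) A a :=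
  ⟨⟨fun y => H (τ * cubeDepth y, γ.1 (cubeExpand τ y)), by
      have := continuous_cubeDepth (m := m)
      have := (continuous_cubeExpand (m := m)).comp (Continuous.prodMk_right τ)
      exact H.continuous.comp ((by fun_prop : Continuous fun y : Fin m → I => τ * cubeDepth y).prodMk
        (γ.1.continuous.comp this))⟩, fun y hy => by
    change H (τ * cubeDepth y, γ.1 (cubeExpand τ y)) = a
    rw [cubeDepth_eq_zero hy, mul_zero, H0, γ.2 _ (cubeExpand_mem_boundary τ hy)]⟩

/-- When `H` ends at `s ∘ f`, the slid loop at `τ = 1` is `s ∘ f ∘ γ` on the inner half and the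
track of the base point on the shell. It thus depends on `γ` only through `f ∘ γ`. -/
theorem slideLoop_homotopic (H : C(I × A, A)) (H0 : ∀ a, H (0, a) = a) {a : A}
    (γ : GenLoop (Fin m) A a) : GenLoop.Homotopic γ (slideLoop H H0 1 γ) := by
  refine ⟨⟨⟨⟨fun p => slideLoop H H0 p.1 γ p.2, ?_⟩, fun y => ?_, fun y => rfl⟩, fun τ y hy => ?_⟩⟩
  · have := continuous_cubeDepth (m := m)
    exact H.continuous.comp ((by fun_prop : Continuous fun p : I × (Fin m → I) =>
      p.1 * cubeDepth p.2).prodMk (γ.1.continuous.comp continuous_cubeExpand))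
  · change H (0 * cubeDepth y, γ.1 (cubeExpand 0 y)) = γ.1 y
    rw [zero_mul, H0, cubeExpand_zero]
  · exact (GenLoop.boundary (slideLoop H H0 τ γ) y hy).trans (γ.2 y hy).symm

/-- Gluing a family of maps on the inner half of the cube with a path on the outer shell. -/
theorem continuous_glueShell {Z : Type*} [TopologicalSpace Z] (q : C(I, A))
    {g : Z × (Fin m → I) → A} (hg : Continuous g)
    (h : ∀ z, ∀ y ∈ Cube.boundary (Fin m), g (z, y) = q 1) :
    Continuous fun p : Z × (Fin m → I) => if cubeDepth p.2 = 1 then g (p.1, cubeExpand 1 p.2)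
      else q (cubeDepth p.2) := by
  have hd : Continuous fun p : Z × (Fin m → I) => cubeDepth p.2 :=
    continuous_cubeDepth.comp continuous_snd
  have he : Continuous fun p : Z × (Fin m → I) => cubeExpand 1 p.2 :=
    continuous_cubeExpand.comp ((Continuous.prodMk_right 1).comp continuous_snd)
  have hb : IsClosed (Cube.boundary (Fin m)) := by
    have : Cube.boundary (Fin m) = ⋃ i, {y | y i = 0} ∪ {y | y i = 1} := by
      ext y; simp [Cube.boundary]
    rw [this]
    exact isClosed_iUnion_of_finite fun i =>
      (isClosed_eq (continuous_apply i) continuous_const).union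
        (isClosed_eq (continuous_apply i) continuous_const)
  have h1 : IsClosed (Set.ofPred fun p : Z × (Fin m → I) => cubeDepth p.2 = 1) :=
    isClosed_eq hd continuous_const
  have h2 : IsClosed (Set.ofPred fun p : Z × (Fin m → I) => cubeExpand 1 p.2 ∈ Cube.boundary (Fin m)) :=
    hb.preimage he
  rw [← continuousOn_univ, ← Set.eq_univ_of_forall fun p : Z × (Fin m → I) =>
    (cubeDepth_eq_one_or p.2 : p ∈ (Set.ofPred fun p : Z × (Fin m → I) => cubeDepth p.2 = 1) ∪
      (Set.ofPred fun p : Z × (Fin m → I) => cubeExpand 1 p.2 ∈ Cube.boundary (Fin m)))]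
  refine ContinuousOn.union_of_isClosed ?_ ?_ h1 h2
  · exact (hg.comp (continuous_fst.prodMk he)).continuousOn.congr fun p hp => if_pos hp
  · refine (q.continuous.comp hd).continuousOn.congr fun p hp => ?_
    dsimp only [Function.comp]
    split_ifs with h'
    · rw [h', h _ _ hp]
    · rfl

/-- A map with a section `s` such that `s ∘ f` is fibrewise homotopic to the identity is a weak
homotopy equivalence. -/
theorem isWeakHomotopyEquiv_of_section (f : C(A, B)) (s : C(B, A)) (hs : ∀ b, f (s b) = b)
    (H : C(I × A, A)) (H0 : ∀ a, H (0, a) = a) (H1 : ∀ a, H (1, a) = s (f a))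
    (hf : ∀ p, f (H p) = f p.2) : IsWeakHomotopyEquiv f := by
  have hj (a : A) : Joined a (s (f a)) :=
    ⟨⟨⟨fun τ => H (τ, a), by fun_prop⟩, H0 a, H1 a⟩⟩
  refine ⟨⟨?_, ?_⟩, fun m _ a => ⟨?_, ?_⟩⟩
  · rintro ⟨a⟩ ⟨a'⟩ h
    refine Quotient.sound ?_
    have h' : Joined (f a) (f a') := Quotient.exact h
    exact (hj a).trans ((h'.map s.continuous).trans (hj a').symm)
  · rintro ⟨b⟩
    exact ⟨Quotient.mk _ (s b), congrArg (Quotient.mk _) (hs b)⟩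
  · rintro ⟨γ⟩ ⟨γ'⟩ h
    refine Quotient.sound ?_
    obtain ⟨K⟩ : (f.comp γ.1).HomotopicRel (f.comp γ'.1) _ := Quotient.exact h
    -- Both slid loops are glued from `s` of the projected loop and the same track of `a`; inserting
    -- the homotopy `K` downstairs into this recipe joins them.
    have key : GenLoop.Homotopic (slideLoop H H0 1 γ) (slideLoop H H0 1 γ') := by
      have hK (r : I) (y : Fin m → I) (hy : y ∈ Cube.boundary (Fin m)) : K (r, y) = f a :=
        (K.eq_fst r hy).trans (congrArg f (γ.2 y hy))
      have hend (δ : GenLoop (Fin m) A a) (y : Fin m → I) : (if cubeDepth y = 1 then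
          s (f (δ.1 (cubeExpand 1 y))) else H (cubeDepth y, a)) = slideLoop H H0 1 δ y := by
        change _ = H (1 * cubeDepth y, δ.1 (cubeExpand 1 y))
        rw [one_mul]
        split_ifs with h'
        · rw [h', H1]
        · rw [δ.2 _ ((cubeDepth_eq_one_or y).resolve_left h')]
      refine ⟨⟨⟨⟨fun p => if cubeDepth p.2 = 1 then s (K (p.1, cubeExpand 1 p.2))
        else H (cubeDepth p.2, a), ?_⟩, fun y => ?_, fun y => ?_⟩, fun r y hy => ?_⟩⟩
      · exact continuous_glueShell (g := fun p => s (K p)) ⟨fun τ => H (τ, a), by fun_prop⟩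
          (by fun_prop) fun z y hy => by simp [hK z y hy, H1]
      · simp only [K.apply_zero]
        exact hend γ y
      · simp only [K.apply_one]
        exact hend γ' y
      · refine Eq.trans ?_ (GenLoop.boundary (slideLoop H H0 1 γ) y hy).symm
        simp [cubeDepth_eq_zero hy, H0]
    exact (slideLoop_homotopic H H0 γ).trans (key.trans (slideLoop_homotopic H H0 γ').symm)
  · rintro ⟨β⟩
    -- The lift `s ∘ β` is based at `s (f a)` rather than `a`; the track of `a` under `H`, placed on
    -- the shell, corrects the base point.
    have hc := continuous_glueShell (Z := Unit) (g := fun p => s (β.1 p.2))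
      ⟨fun τ => H (τ, a), by fun_prop⟩ (by fun_prop) fun z y hy => by
        simp [show β.1 y = f a from β.2 y hy, H1]
    refine ⟨Quotient.mk _ ⟨⟨_, hc.comp (Continuous.prodMk_right ())⟩, fun y hy => ?_⟩,
      Quotient.sound (GenLoop.Homotopic.symm ?_)⟩
    · simp [cubeDepth_eq_zero hy, H0]
    -- As `f` is constant on tracks of `H`, the lift projects to `β ∘ cubeExpand 1`, which is
    -- homotopic to `β` by varying the expansion parameter.
    · refine ⟨⟨⟨⟨fun p => β.1 (cubeExpand p.1 p.2),
        β.1.continuous.comp continuous_cubeExpand⟩, fun y => ?_, fun y => ?_⟩, fun r y hy => ?_⟩⟩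
      · exact congrArg β.1 (cubeExpand_zero y)
      · change β.1 (cubeExpand 1 y) = f (if cubeDepth y = 1 then s (β.1 (cubeExpand 1 y)) else
          H (cubeDepth y, a))
        split_ifs with h'
        · rw [hs]
        · rw [hf]
          exact β.2 _ ((cubeDepth_eq_one_or y).resolve_left h')
      · exact (β.2 _ (cubeExpand_mem_boundary r hy)).trans (β.2 y hy).symm

end CubeShrinking

/-! ### Separated sequences of non-orbifold points -/

/-- A sequence of non-orbifold points with invariant functions `bump a`, such that `bump a` vanishes
near the `a`-th point and the zero sets of the functions are pairwise disjoint. -/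
structure TopGroupoid.SeparatedPoints (G : TopGroupoid.{u}) where
  /-- The points. -/
  pt : ℕ → G.Ob
  /-- The invariant functions. -/
  bump : ℕ → G.Ob → ℝ
  not_isOrbifoldPoint : ∀ a, ¬ G.IsOrbifoldPoint (pt a)
  continuous_bump : ∀ a, Continuous (bump a)
  bump_nonneg : ∀ a x, 0 ≤ bump a x
  bump_le_one : ∀ a x, bump a x ≤ 1
  bump_congr : ∀ a {x y}, G.Linked x y → bump a x = bump a y
  bump_eventually : ∀ a {x}, G.Linked x (pt a) → ∀ᶠ y in 𝓝 x, bump a y = 0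
  eq_of_bump : ∀ {x a b}, bump a x = 0 → bump b x = 0 → a = b

theorem TopGroupoid.SeparatedPoints.eq_of_linked {G : TopGroupoid.{u}} (w : G.SeparatedPoints)
    {a b : ℕ} (h : G.Linked (w.pt a) (w.pt b)) : a = b :=
  w.eq_of_bump (w.bump_eventually a (G.linked_refl _)).self_of_nhds
    (w.bump_eventually b h).self_of_nhds

/-! ### Separated points on an orbifold of positive dimension -/

namespace Orbifold

variable {d : ℕ} (X : Orbifold.{u} d)

/-- The unit map is a continuous section of the local homeomorphism `src`. -/
theorem isOpenMap_one : IsOpenMap X.one := by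
  refine (IsLocalHomeomorph.of_comp (g := X.src) ?_
    X.isLocalDiffeomorph_src.isLocalHomeomorph X.continuous_one).isOpenMap
  rw [show X.src ∘ X.one = id from funext X.src_one]
  exact Homeomorph.isLocalHomeomorph (Homeomorph.refl _)

theorem isClosed_linked : IsClosed (Set.ofPred fun p : X.Ob × X.Ob => X.Linked p.1 p.2) := by
  convert X.isProperMap_src_tgt.isClosedMap.isClosed_range using 1
  ext ⟨x, y⟩
  simp [TopGroupoid.Linked]

/-- The saturation of an open set `O` is `t (s⁻¹ O)`, and `t` is open. -/
theorem isOpenMap_coarse : IsOpenMap (Quotient.mk X.setoid) := by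
  intro O hO
  have : IsOpen (X.tgt '' (X.src ⁻¹' O)) :=
    X.isLocalDiffeomorph_tgt.isLocalHomeomorph.isOpenMap _ (hO.preimage X.continuous_src)
  change IsOpen (Quotient.mk X.setoid ⁻¹' _)
  convert this using 1
  ext y
  constructor
  · rintro ⟨x, hx, h⟩
    obtain ⟨g, rfl, rfl⟩ : X.Linked x y := Quotient.exact h
    exact ⟨g, hx, rfl⟩
  · rintro ⟨g, hg, rfl⟩
    exact ⟨X.src g, hg, Quotient.sound (X.linked_src_tgt g)⟩

/-- Near a non-orbifold point there are no non-identity arrows. -/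
theorem exists_isOpen_arrows_eq_one {q : X.Ob} (hq : ¬ X.IsOrbifoldPoint q) :
    ∃ W : Set X.Ob, IsOpen W ∧ q ∈ W ∧ ∀ g : X.Ar, X.src g ∈ W → X.tgt g ∈ W →
      g ∈ Set.range X.one := by
  -- The units are open, so the non-identity arrows form a closed set, whose image under the proper
  -- map `(s, t)` is closed. Trivial isotropy at `q` says that `(q, q)` is not in this image.
  have hC := X.isProperMap_src_tgt.isClosedMap _ X.isOpenMap_one.isOpen_range.isClosed_compl
  have hq' : (q, q) ∈ ((fun g => (X.src g, X.tgt g)) '' (Set.range X.one)ᶜ)ᶜ := by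
    rintro ⟨g, hg, h⟩
    refine hq ⟨⟨⟨g, congrArg Prod.fst h, congrArg Prod.snd h⟩,
      ⟨X.one q, X.src_one q, X.tgt_one q⟩, fun h' => hg ⟨q, ?_⟩⟩⟩
    exact (congrArg Subtype.val h').symm
  obtain ⟨U, V, hU, hV, hqU, hqV, hUV⟩ := isOpen_prod_iff.1 hC.isOpen_compl q q hq'
  refine ⟨U ∩ V, hU.inter hV, ⟨hqU, hqV⟩, fun g h1 h2 => ?_⟩
  by_contra hg
  exact hUV (a := (X.src g, X.tgt g)) ⟨h1.1, h2.2⟩ ⟨g, hg, rfl⟩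

/-- Positive dimension enters here: Euclidean space then has no isolated points, and charts
transport this to the object space. -/
theorem infinite_of_isOpen (hd : 1 ≤ d) {W : Set X.Ob} (hW : IsOpen W) {q : X.Ob} (hq : q ∈ W) :
    W.Infinite := by
  let e := chartAt (EuclideanSpace ℝ (Fin d)) q
  have : Nonempty (Fin d) := ⟨⟨0, hd⟩⟩
  have ho : IsOpen (e '' (e.source ∩ W)) := e.isOpen_image_source_inter hW
  have hi : (e '' (e.source ∩ W)).Infinite :=
    infinite_of_mem_nhds (e q) (ho.mem_nhds ⟨q, ⟨mem_chart_source _ q, hq⟩, rfl⟩)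
  exact fun h => hi ((h.inter_of_right _).image e)

/-- An orbifold of positive dimension with a non-orbifold point has a separated sequence of
non-orbifold points. -/
theorem nonempty_separatedPoints (hd : 1 ≤ d) (hX : ∃ x : X.Ob, ¬ X.IsOrbifoldPoint x) :
    Nonempty X.SeparatedPoints := by
  obtain ⟨q, hq⟩ := hX
  obtain ⟨W, hW, hqW, hone⟩ := X.exists_isOpen_arrows_eq_one hq
  have : Infinite W := (X.infinite_of_isOpen hd hW hqW).to_subtype
  obtain ⟨O, hOi, hO, hOd⟩ := exists_seq_infinite_isOpen_pairwise_disjoint W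
  choose p hp using fun a => (hOi a).nonempty
  have hlink {x y : W} (h : X.Linked x y) : x = y := by
    obtain ⟨g, h1, h2⟩ := h
    obtain ⟨z, rfl⟩ := hone g (h1 ▸ x.2) (h2 ▸ y.2)
    rw [X.src_one] at h1
    rw [X.tgt_one] at h2
    exact Subtype.ext (h1.symm.trans h2)
  have := X.t2Coarse
  have := X.paracompactCoarse
  let π : X.Ob → X.Coarse := Quotient.mk X.setoid
  have hπ : Continuous π := continuous_quotient_mk'
  let Q (a : ℕ) : Set X.Coarse := π '' (Subtype.val '' O a)
  have hQ (a : ℕ) : IsOpen (Q a) := X.isOpenMap_coarse _ (hW.isOpenMap_subtype_val _ (hO a))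
  have hQd {a b : ℕ} {z : X.Coarse} (ha : z ∈ Q a) (hb : z ∈ Q b) : a = b := by
    obtain ⟨_, ⟨x, hx, rfl⟩, rfl⟩ := ha
    obtain ⟨_, ⟨y, hy, rfl⟩, h⟩ := hb
    obtain rfl := hlink (Quotient.exact h : X.Linked y x)
    by_contra hab
    exact Set.disjoint_left.1 (hOd hab) hx hy
  -- The coarse space is normal, being paracompact Hausdorff. Shrinking to `V` makes the Urysohn
  -- function vanish on a whole neighbourhood of the point; being `1` off `Q a` keeps the zero sets
  -- disjoint.
  have hu (a : ℕ) : ∃ f : C(X.Coarse, ℝ), (∀ᶠ z in 𝓝 (π (p a)), f z = 0) ∧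
      Set.EqOn f 1 (Q a)ᶜ ∧ ∀ z, f z ∈ Set.Icc (0 : ℝ) 1 := by
    obtain ⟨V, hV, hpV, hVQ⟩ := normal_exists_closure_subset (isClosed_singleton (x := π (p a)))
      (hQ a) (Set.singleton_subset_iff.2 ⟨_, ⟨p a, hp a, rfl⟩, rfl⟩)
    obtain ⟨f, hf0, hf1, hf⟩ := exists_continuous_zero_one_of_isClosed isClosed_closure
      (hQ a).isClosed_compl (Set.disjoint_compl_right_iff_subset.2 hVQ)
    exact ⟨f, Filter.eventually_of_mem (hV.mem_nhds (Set.singleton_subset_iff.1 hpV))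
      fun z hz => hf0 (subset_closure hz), hf1, hf⟩
  choose f hf0 hf1 hf using hu
  have hfQ {a : ℕ} {z : X.Coarse} (h : f a z = 0) : z ∈ Q a := by
    by_contra h'
    have := hf1 a h'
    rw [h] at this
    exact zero_ne_one this
  refine ⟨⟨fun a => p a, fun a x => f a (π x), fun a => ?_, fun a => (f a).continuous.comp hπ,
    fun a x => (hf a _).1, fun a x => (hf a _).2, fun a x y h => ?_, fun a x h => ?_,
    fun h h' => hQd (hfQ h) (hfQ h')⟩⟩
  · rintro ⟨g, g', hgg⟩
    apply hgg
    obtain ⟨z, hz⟩ := hone g.1 (by rw [g.2.1]; exact (p a).2) (by rw [g.2.2]; exact (p a).2)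
    obtain ⟨z', hz'⟩ := hone g'.1 (by rw [g'.2.1]; exact (p a).2)
      (by rw [g'.2.2]; exact (p a).2)
    have h1 := g.2.1
    have h2 := g'.2.1
    rw [← hz, X.src_one] at h1
    rw [← hz', X.src_one] at h2
    exact Subtype.ext (by rw [← hz, ← hz', h1, h2])
  · exact congrArg (f a) (Quotient.sound h)
  · have : π x = π (p a) := Quotient.sound h
    exact hπ.continuousAt.eventually (this ▸ hf0 a)

end Orbifold

namespace TopGroupoid

variable {G : TopGroupoid.{u}} {n : ℕ}

/-! ### Points of the resolution -/

/-- A family of non-orbifold points which are pairwise not linked, and not linked to the points of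
a configuration. -/
structure ConfOb.IsFree {A : Type*} (S : G.ConfOb n) (p : A → G.Ob) : Prop where
  not_linked_conf : ∀ a, ∀ x ∈ S.1, ¬ G.Linked x (p a)
  pairwise : Pairwise fun a b => ¬ G.Linked (p a) (p b)
  not_isOrbifoldPoint : ∀ a, ¬ G.IsOrbifoldPoint (p a)

theorem ConfOb.IsFree.comp {A A' : Type*} {S : G.ConfOb n} {p : A → G.Ob} (h : S.IsFree p)
    {θ : A' → A} (hθ : Function.Injective θ) : S.IsFree (p ∘ θ) :=
  ⟨fun _ => h.1 _, fun _ _ hab => h.2 (hθ.ne hab), fun _ => h.3 _⟩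

/-- Having `n + i + 1` elements means that the concatenated enumeration is injective. Freeness
replaces this count by pairwise conditions, which make sense for any index set and pass to
subfamilies. -/
theorem isResolutionOb_iff [T2Space G.Ob] {i : ℕ} (S : G.ConfOb n) (p : Fin (i + 1) → G.Ob) :
    G.IsResolutionOb n i (S, p) ↔ S.IsFree p := by
  obtain ⟨S, hS, hS'⟩ := S
  obtain ⟨x, hx, rfl⟩ := exists_range_eq hS
  have hcard : (Set.range x ∪ Set.range p).encard = (n + (i + 1) : ℕ) ↔
      Function.Injective (Sum.elim x p) := by
    classical
    rw [← Set.Sum.elim_range]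
    constructor
    · intro hc
      have hcard : (Finset.univ.image (Sum.elim x p)).card =
          Fintype.card (Fin n ⊕ Fin (i + 1)) := by
        rw [← ENat.natCast_inj, ← Set.encard_coe_eq_coe_finsetCard]
        simpa using hc
      have := Finset.card_image_iff.1 hcard
      rwa [Finset.coe_univ, Set.injOn_univ] at this
    · intro h
      rw [← Set.image_univ, h.encard_image, Set.encard_univ]
      simp
  constructor
  · rintro ⟨⟨hc, hp⟩, ho⟩
    have hinj := hcard.1 hc
    refine ⟨fun a y hy => hp (Or.inl hy) (Or.inr ⟨a, rfl⟩) ?_,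
      fun a b hab => hp (Or.inr ⟨a, rfl⟩) (Or.inr ⟨b, rfl⟩) ?_, ho⟩
    · obtain ⟨l, rfl⟩ := hy
      exact fun h => Sum.inl_ne_inr (hinj (a₁ := Sum.inl l) (a₂ := Sum.inr a) h)
    · exact fun h => hab (Sum.inr_injective (hinj (a₁ := Sum.inr a) (a₂ := Sum.inr b) h))
  · rintro ⟨h1, h2, h3⟩
    refine ⟨⟨hcard.2 ?_, ?_⟩, h3⟩
    · refine Function.Injective.sumElim hx (fun a b hab => ?_) fun l a h => ?_
      · by_contra h
        exact h2 h (hab ▸ G.linked_refl _)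
      · exact h1 a _ ⟨l, rfl⟩ (h ▸ G.linked_refl _)
    · rintro y (hy | ⟨a, rfl⟩) z (hz | ⟨b, rfl⟩) hyz
      · exact hS' hy hz hyz
      · exact h1 b y hy
      · exact fun h => h1 a z hz (G.linked_symm h)
      · exact h2 fun hab => hyz (hab ▸ rfl)

variable [T2Space G.Ob]

/-- A family of chains which is free at each object of a chain of configurations. -/
def NerveSimplex.IsFree {A : Type*} {k : ℕ} (γ : (G.conf n).NerveSimplex k)
    (v : A → G.NerveSimplex k) : Prop :=
  ∀ c, ConfOb.IsFree (γ.ob c) fun a => (v a).ob c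

/-- The simplex of the nerve of the resolution given by a chain of configurations and a free family
of chains. -/
def NerveSimplex.join {k i : ℕ} (γ : (G.conf n).NerveSimplex k) (v : Fin (i + 1) → G.NerveSimplex k)
    (h : γ.IsFree v) : (G.confResolution n i).NerveSimplex k where
  ob c := ⟨(γ.ob c, fun l => (v l).ob c), (isResolutionOb_iff _ _).2 (h c)⟩
  ar c e hce := ⟨(γ.ar c e hce, fun l => (v l).ar c e hce), by
    constructor
    · refine (isResolutionOb_iff ((G.conf n).src (γ.ar c e hce))
        fun l => G.src ((v l).ar c e hce)).2 ?_
      simpa only [γ.src_ar, (v _).src_ar] using h c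
    · refine (isResolutionOb_iff ((G.conf n).tgt (γ.ar c e hce))
        fun l => G.tgt ((v l).ar c e hce)).2 ?_
      simpa only [γ.tgt_ar, (v _).tgt_ar] using h e⟩
  src_ar c e hce := Subtype.ext
    (Prod.ext (γ.src_ar c e hce) (funext fun l => (v l).src_ar c e hce))
  tgt_ar c e hce := Subtype.ext
    (Prod.ext (γ.tgt_ar c e hce) (funext fun l => (v l).tgt_ar c e hce))
  ar_refl c := Subtype.ext (Prod.ext (γ.ar_refl c) (funext fun l => (v l).ar_refl c))
  ar_trans a b c hab hbc := Subtype.ext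
    (Prod.ext (γ.ar_trans a b c hab hbc) (funext fun l => (v l).ar_trans a b c hab hbc))

/-- The chain of configurations underlying a simplex of the nerve of the resolution. -/
abbrev NerveSimplex.base {k i : ℕ} (x : (G.confResolution n i).NerveSimplex k) :
    (G.conf n).NerveSimplex k :=
  x.map (G.confForget n i)

/-- The chains of extra points of a simplex of the nerve of the resolution. -/
def NerveSimplex.vertex {k i : ℕ} (x : (G.confResolution n i).NerveSimplex k) (l : Fin (i + 1)) :
    G.NerveSimplex k where
  ob c := (x.ob c).1.2 l
  ar c e h := (x.ar c e h).1.2 l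
  src_ar c e h := congrFun (congrArg (fun y => y.1.2) (x.src_ar c e h)) l
  tgt_ar c e h := congrFun (congrArg (fun y => y.1.2) (x.tgt_ar c e h)) l
  ar_refl c := congrFun (congrArg (fun y => y.1.2) (x.ar_refl c)) l
  ar_trans a b c hab hbc := congrFun (congrArg (fun y => y.1.2) (x.ar_trans a b c hab hbc)) l

theorem NerveSimplex.isFree_vertex {k i : ℕ} (x : (G.confResolution n i).NerveSimplex k) :
    x.base.IsFree x.vertex :=
  fun c => (isResolutionOb_iff _ _).1 (x.ob c).2

theorem NerveSimplex.continuous_base {k i : ℕ} :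
    Continuous (NerveSimplex.base : (G.confResolution n i).NerveSimplex k → _) :=
  NerveSimplex.continuous_map _ _

theorem NerveSimplex.continuous_vertex {k i : ℕ} (l : Fin (i + 1)) :
    Continuous fun x : (G.confResolution n i).NerveSimplex k => x.vertex l := by
  have h1 : Continuous fun x : (G.confResolution n i).Ob => x.1.2 l :=
    (continuous_apply l).comp (continuous_snd.comp continuous_subtype_val)
  have h2 : Continuous fun f : (G.confResolution n i).Ar => f.1.2 l :=
    (continuous_apply l).comp (continuous_snd.comp continuous_subtype_val)
  exact continuous_nerve_iff _ (fun c => h1.comp (continuous_nerve_ob _ c))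
    fun c e h => h2.comp (continuous_nerve_ar _ c e h)

theorem NerveSimplex.continuous_join {k i : ℕ} {Z : Type*} [TopologicalSpace Z]
    {γ : Z → (G.conf n).NerveSimplex k} {v : Z → Fin (i + 1) → G.NerveSimplex k}
    (hγ : Continuous γ) (hv : ∀ l, Continuous fun z => v z l) (h : ∀ z, (γ z).IsFree (v z)) :
    Continuous fun z => (γ z).join (v z) (h z) :=
  continuous_nerve_iff _
    (fun c => continuous_induced_rng.2 (((continuous_nerve_ob _ c).comp hγ).prodMk
      (continuous_pi fun l => (continuous_nerve_ob _ c).comp (hv l))))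
    (fun c e hce => continuous_induced_rng.2 (((continuous_nerve_ar _ c e hce).comp hγ).prodMk
      (continuous_pi fun l => (continuous_nerve_ar _ c e hce).comp (hv l))))

theorem NerveSimplex.IsFree.comp {A A' : Type*} {k : ℕ} {γ : (G.conf n).NerveSimplex k}
    {v : A → G.NerveSimplex k} (h : γ.IsFree v) {θ : A' → A} (hθ : Function.Injective θ) :
    γ.IsFree (v ∘ θ) :=
  fun c => (h c).comp hθ

variable (G n) in
/-- The realisation of the resolution. -/
abbrev Resolution : TopCat.{u} := fatRealization (G.classifyingConfSemisimplicial n)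

variable (G n) in
/-- The classifying space of the configuration groupoid. -/
abbrev ConfSpace : TopCat.{u} := classifyingSpace.obj (G.conf n)

/-- The point of the resolution given by a simplex of the nerve and points of two simplices. -/
def resMk' {k i : ℕ} (x : (G.confResolution n i).NerveSimplex k) (t : stdSimplex ℝ (Fin (k + 1)))
    (s : stdSimplex ℝ (Fin (i + 1))) : G.Resolution n :=
  Quot.mk _ ⟨i, (Quot.mk _ ⟨k, x, t⟩ : Quot (RealizationRel (nerve.obj (G.confResolution n i)))), s⟩

/-- The point of the resolution given by a chain of configurations, a free family of chains, and
points of two simplices. -/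
abbrev resMk {k i : ℕ} (γ : (G.conf n).NerveSimplex k) (v : Fin (i + 1) → G.NerveSimplex k)
    (h : γ.IsFree v) (t : stdSimplex ℝ (Fin (k + 1))) (s : stdSimplex ℝ (Fin (i + 1))) :
    G.Resolution n :=
  resMk' (γ.join v h) t s

theorem resMk'_reindex {k m i : ℕ} (θ : Fin (k + 1) →o Fin (m + 1))
    (x : (G.confResolution n i).NerveSimplex m) (t : stdSimplex ℝ (Fin (k + 1)))
    (s : stdSimplex ℝ (Fin (i + 1))) :
    resMk' (x.reindex θ) t s = resMk' x (stdSimplex.map θ t) s :=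
  congrArg (fun y : Quot (RealizationRel (nerve.obj (G.confResolution n i))) =>
    (Quot.mk _ ⟨i, y, s⟩ : G.Resolution n))
    (Quot.sound (RealizationRel.glue (Y := nerve.obj (G.confResolution n i)) (k := k) (m := m)
      (SimplexCategory.Hom.mk θ) x t))

theorem resMk'_face {k i j : ℕ} (θ : Fin (i + 1) ↪o Fin (j + 1))
    (x : (G.confResolution n j).NerveSimplex k) (t : stdSimplex ℝ (Fin (k + 1)))
    (s : stdSimplex ℝ (Fin (i + 1))) :
    resMk' (x.map (G.confFace n θ)) t s = resMk' x t (stdSimplex.map θ s) :=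
  Quot.sound (FatRealizationRel.glue (Y := G.classifyingConfSemisimplicial n) (i := i) (j := j)
    (SemiSimplexCategory.homEquiv.symm θ)
    (Quot.mk _ ⟨k, x, t⟩ : Quot (RealizationRel (nerve.obj (G.confResolution n j)))) s)

theorem resMk_comp {k i j : ℕ} (θ : Fin (i + 1) ↪o Fin (j + 1)) {γ : (G.conf n).NerveSimplex k}
    {v : Fin (j + 1) → G.NerveSimplex k} (h : γ.IsFree v) {v' : Fin (i + 1) → G.NerveSimplex k}
    (h' : γ.IsFree v') (hv : v' = v ∘ θ) (t : stdSimplex ℝ (Fin (k + 1)))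
    {s : stdSimplex ℝ (Fin (j + 1))} {s' : stdSimplex ℝ (Fin (i + 1))}
    (hs : stdSimplex.map θ s' = s) : resMk γ v' h' t s' = resMk γ v h t s := by
  subst hv hs
  exact resMk'_face θ (γ.join v h) t s'

theorem continuous_resMk' {k i : ℕ} : Continuous fun p : (G.confResolution n i).NerveSimplex k ×
    stdSimplex ℝ (Fin (k + 1)) × stdSimplex ℝ (Fin (i + 1)) =>
      (resMk' p.1 p.2.1 p.2.2 : G.Resolution n) := by
  let Y := nerve.obj (G.confResolution n i)
  have h1 : Continuous fun p : (G.confResolution n i).NerveSimplex k ×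
      stdSimplex ℝ (Fin (k + 1)) × stdSimplex ℝ (Fin (i + 1)) =>
      (Quot.mk _ ⟨k, p.1, p.2.1⟩ : Quot (RealizationRel Y)) :=
    continuous_quot_mk.comp ((continuous_sigmaMk (σ := fun k : ℕ =>
      Y.obj (op ⦋k⦌) × stdSimplex ℝ (Fin (k + 1)))).comp
      (continuous_fst.prodMk (continuous_fst.comp continuous_snd)))
  exact continuous_quot_mk.comp ((continuous_sigmaMk (σ := fun i : ℕ =>
    (G.classifyingConfSemisimplicial n).obj (op ⦋i⦌ₛ) × stdSimplex ℝ (Fin (i + 1)))).comp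
    (h1.prodMk (continuous_snd.comp continuous_snd)))

end TopGroupoid

namespace TopGroupoid

variable {G : TopGroupoid.{u}} {n : ℕ}

/-! ### Topology of spaces of configurations -/

theorem OrdConf.isOpenQuotientMap_forget :
    IsOpenQuotientMap (OrdConf.forget : G.OrdConf n → _) := by
  refine ⟨OrdConf.forget_surjective, OrdConf.isQuotientMap_forget.continuous, fun U hU => ?_⟩
  rw [← OrdConf.isQuotientMap_forget.isOpen_preimage]
  let act (r : Equiv.Perm (Fin n)) (x : G.OrdConf n) : G.OrdConf n :=
    ⟨fun i => x.1 (r i), fun i j hij => x.2 (r.injective.ne hij)⟩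
  have hact : ∀ r, Continuous (act r) := fun r => by
    have : Continuous fun (x : G.OrdConf n) i => x.1 (r i) :=
      continuous_pi fun i => (continuous_apply (r i)).comp continuous_subtype_val
    exact this.subtype_mk _
  have : OrdConf.forget ⁻¹' (OrdConf.forget '' U) = ⋃ r, act r ⁻¹' U := by
    ext x
    simp only [Set.mem_preimage, Set.mem_image, Set.mem_iUnion]
    constructor
    · rintro ⟨y, hy, h⟩
      obtain ⟨r, hr⟩ := exists_perm y.injective x.injective (congrArg Subtype.val h)
      exact ⟨r, by rwa [show act r x = y from Subtype.ext (funext hr)]⟩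
    · rintro ⟨r, hr⟩
      exact ⟨act r x, hr, Subtype.ext (r.surjective.range_comp x.1)⟩
  rw [this]
  exact isOpen_iUnion fun r => hU.preimage (hact r)

/-- Closedness can be tested on ordered configurations because the quotient map is open and so stays
a quotient map after taking the product with `G.Ob`; there the set is a finite union of closed sets.
-/
theorem isClosed_exists_mem_linked
    (hL : IsClosed (Set.ofPred fun p : G.Ob × G.Ob => G.Linked p.1 p.2)) :
    IsClosed (Set.ofPred fun p : G.ConfOb n × G.Ob => ∃ x ∈ p.1.1, G.Linked x p.2) := by
  have hq := (OrdConf.isOpenQuotientMap_forget (G := G) (n := n)).prodMap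
    (IsOpenQuotientMap.id (X := G.Ob))
  rw [← hq.isQuotientMap.isClosed_preimage]
  have : Prod.map (OrdConf.forget (G := G) (n := n)) id ⁻¹'
      (Set.ofPred fun p : G.ConfOb n × G.Ob => ∃ x ∈ p.1.1, G.Linked x p.2) =
      ⋃ i, Set.ofPred fun p : G.OrdConf n × G.Ob => G.Linked (p.1.1 i) p.2 := by
    ext p
    simp [OrdConf.forget]
  rw [this]
  refine isClosed_iUnion_of_finite fun i => hL.preimage (f := fun p : G.OrdConf n × G.Ob =>
    (p.1.1 i, p.2)) ?_
  exact ((continuous_apply i).comp (continuous_subtype_val.comp continuous_fst)).prodMk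
    continuous_snd

/-- The product of the values of a function at the points of a configuration. -/
noncomputable def ConfOb.prod (S : G.ConfOb n) (f : G.Ob → ℝ) : ℝ := ∏ᶠ x ∈ S.1, f x

theorem ConfOb.continuous_prod {f : G.Ob → ℝ} (hf : Continuous f) :
    Continuous fun S : G.ConfOb n => S.prod f := by
  refine OrdConf.isQuotientMap_forget.continuous_iff.2 ?_
  have : (fun S : G.ConfOb n => S.prod f) ∘ OrdConf.forget = fun x => ∏ i, f (x.1 i) := by
    funext x
    exact (finprod_mem_range x.injective).trans (finprod_eq_prod_of_fintype _)
  rw [this]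
  exact continuous_finsetProd _ fun i _ =>
    hf.comp ((continuous_apply i).comp continuous_subtype_val)

theorem ConfOb.finite (S : G.ConfOb n) : S.1.Finite := Set.finite_of_encard_eq_coe S.2.1

theorem ConfOb.prod_eq_zero_iff (S : G.ConfOb n) (f : G.Ob → ℝ) :
    S.prod f = 0 ↔ ∃ x ∈ S.1, f x = 0 := by
  rw [ConfOb.prod, finprod_mem_eq_finite_toFinset_prod _ S.finite, Finset.prod_eq_zero_iff]
  simp

theorem ConfOb.prod_nonneg (S : G.ConfOb n) {f : G.Ob → ℝ} (hf : ∀ x, 0 ≤ f x) : 0 ≤ S.prod f := by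
  rw [ConfOb.prod, finprod_mem_eq_finite_toFinset_prod _ S.finite]
  exact Finset.prod_nonneg fun x _ => hf x

theorem ConfAr.prod_src_eq_prod_tgt (A : G.ConfAr n) {f : G.Ob → ℝ}
    (hf : ∀ {x y}, G.Linked x y → f x = f y) : A.src.prod f = A.tgt.prod f := by
  change ∏ᶠ x ∈ G.src '' A.1, f x = ∏ᶠ x ∈ G.tgt '' A.1, f x
  rw [finprod_mem_image A.src_injOn, finprod_mem_image A.tgt_injOn]
  simp_rw [hf (G.linked_src_tgt _)]

theorem NerveSimplex.linked {k : ℕ} (v : G.NerveSimplex k) (c e : Fin (k + 1)) :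
    G.Linked (v.ob c) (v.ob e) := by
  rcases le_total c e with h | h
  · exact ⟨v.ar c e h, v.src_ar _ _ _, v.tgt_ar _ _ _⟩
  · exact G.linked_symm ⟨v.ar e c h, v.src_ar _ _ _, v.tgt_ar _ _ _⟩

variable [T2Space G.Ob]

/-- The arrows of a chain match the points of its configurations up to linkage. Weights built from
invariant functions may therefore be read off at any object of the chain, which makes them
compatible with the operators of the nerve. -/
theorem NerveSimplex.prod_ob_eq {k : ℕ} (γ : (G.conf n).NerveSimplex k) (c e : Fin (k + 1))
    {f : G.Ob → ℝ} (hf : ∀ {x y}, G.Linked x y → f x = f y) :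
    ConfOb.prod (γ.ob c) f = ConfOb.prod (γ.ob e) f := by
  obtain ⟨A, h, h'⟩ := γ.linked c e
  rw [← h, ← h']
  exact ConfAr.prod_src_eq_prod_tgt A hf

/-! ### Weighted families of chains -/

/-- Rescaling non-negative weights to total weight one. -/
noncomputable def normalize {i : ℕ} (s : Fin (i + 1) → ℝ) (h0 : ∀ l, 0 ≤ s l) (h1 : ∃ l, 0 < s l) :
    stdSimplex ℝ (Fin (i + 1)) :=
  ⟨fun l => s l / ∑ l, s l, fun l => div_nonneg (h0 l) (Finset.sum_nonneg fun l _ => h0 l), by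
    rw [← Finset.sum_div]
    obtain ⟨l, hl⟩ := h1
    exact div_self (Finset.sum_pos' (fun l _ => h0 l) ⟨l, Finset.mem_univ _, hl⟩).ne'⟩

theorem continuous_normalize {Z : Type*} [TopologicalSpace Z] {i : ℕ} {s : Z → Fin (i + 1) → ℝ}
    (hs : ∀ l, Continuous fun z => s z l) (h0 : ∀ z l, 0 ≤ s z l) (h1 : ∀ z, ∃ l, 0 < s z l) :
    Continuous fun z => normalize (s z) (h0 z) (h1 z) := by
  refine Continuous.subtype_mk (continuous_pi fun l => (hs l).div
    (continuous_finsetSum _ fun l _ => hs l) fun z => ?_) _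
  obtain ⟨l, hl⟩ := h1 z
  exact (Finset.sum_pos' (fun l _ => h0 z l) ⟨l, Finset.mem_univ _, hl⟩).ne'

theorem normalize_coe {i : ℕ} (s : stdSimplex ℝ (Fin (i + 1))) (h0 h1) : normalize s h0 h1 = s := by
  refine Subtype.ext (funext fun l => ?_)
  change s l / ∑ l, s l = s l
  rw [stdSimplex.sum_eq_one, div_one]

theorem map_apply_of_injective {i j : ℕ} {θ : Fin (i + 1) → Fin (j + 1)} (hθ : θ.Injective)
    (s : stdSimplex ℝ (Fin (i + 1))) (l : Fin (i + 1)) : stdSimplex.map θ s (θ l) = s l := by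
  classical
  rw [stdSimplex.map_coe, FunOnFinite.linearMap_apply_apply]
  simp only [hθ.eq_iff]
  rw [Finset.sum_filter]
  simp

theorem map_apply_of_notMem {i j : ℕ} {θ : Fin (i + 1) → Fin (j + 1)}
    (s : stdSimplex ℝ (Fin (i + 1))) {l : Fin (j + 1)} (hl : l ∉ Set.range θ) :
    stdSimplex.map θ s l = 0 := by
  classical
  rw [stdSimplex.map_coe, FunOnFinite.linearMap_apply_apply]
  refine Finset.sum_eq_zero fun a ha => ?_
  exact absurd ⟨a, (Finset.mem_filter.1 ha).2⟩ hl

theorem map_normalize {i j : ℕ} {θ : Fin (i + 1) → Fin (j + 1)} (hθ : θ.Injective)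
    {s : Fin (j + 1) → ℝ} (hs : ∀ l ∉ Set.range θ, s l = 0) (h0 h1 h0' h1') :
    stdSimplex.map θ (normalize (s ∘ θ) h0' h1') = normalize s h0 h1 := by
  refine stdSimplex.ext (funext fun l => ?_)
  have hsum : ∑ l, s (θ l) = ∑ l, s l := Fintype.sum_of_injective θ hθ _ _ hs fun _ => rfl
  by_cases hl : l ∈ Set.range θ
  · obtain ⟨l, rfl⟩ := hl
    rw [map_apply_of_injective hθ]
    change s (θ l) / ∑ l, s (θ l) = s (θ l) / ∑ l, s l
    rw [hsum]
  · rw [map_apply_of_notMem _ hl]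
    change 0 = s l / ∑ l, s l
    rw [hs l hl, zero_div]

variable {A A' : Type}

/-- Weights for a family of chains such that the chains with non-zero weight form a finite
non-empty free family. -/
structure IsWeight {k : ℕ} (γ : (G.conf n).NerveSimplex k) (v : A → G.NerveSimplex k)
    (s : A → ℝ) : Prop where
  nonneg : ∀ a, 0 ≤ s a
  finite : (Function.support s).Finite
  exists_pos : ∃ a, 0 < s a
  isFree : γ.IsFree fun a : Function.support s => v a

section
variable {k : ℕ} {γ : (G.conf n).NerveSimplex k} {v : A → G.NerveSimplex k} {s : A → ℝ}

theorem IsWeight.card_eq (h : IsWeight γ v s) :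
    h.finite.toFinset.card = (h.finite.toFinset.card - 1) + 1 := by
  obtain ⟨a, ha⟩ := h.exists_pos
  have : 0 < h.finite.toFinset.card := Finset.card_pos.2 ⟨a, by simpa using ha.ne'⟩
  omega

theorem IsWeight.exists_pos_of_range (h : IsWeight γ v s) {B : Type*} {θ : B → A}
    (hθ : ∀ a ∉ Set.range θ, s a = 0) : ∃ l, 0 < s (θ l) := by
  obtain ⟨a, ha⟩ := h.exists_pos
  by_cases h' : a ∈ Set.range θ
  · obtain ⟨l, rfl⟩ := h'
    exact ⟨l, ha⟩
  · exact absurd (hθ a h') ha.ne'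

variable [LinearOrder A] [LinearOrder A']

/-- The increasing enumeration of the support of a weight. -/
noncomputable def IsWeight.emb (h : IsWeight γ v s) :
    Fin ((h.finite.toFinset.card - 1) + 1) ↪o A :=
  h.finite.toFinset.orderEmbOfFin h.card_eq

theorem IsWeight.range_emb (h : IsWeight γ v s) : Set.range h.emb = Function.support s := by
  rw [IsWeight.emb, Finset.range_orderEmbOfFin, Set.Finite.coe_toFinset]

theorem IsWeight.emb_mem_support (h : IsWeight γ v s) (l) : h.emb l ∈ Function.support s :=
  h.range_emb.subset ⟨l, rfl⟩

theorem IsWeight.eq_zero_of_notMem_range (h : IsWeight γ v s) : ∀ a ∉ Set.range h.emb, s a = 0 := by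
  intro a ha
  rw [h.range_emb] at ha
  simpa using ha

theorem IsWeight.isFree_emb (h : IsWeight γ v s) : γ.IsFree (v ∘ h.emb) :=
  h.isFree.comp (θ := fun l => (⟨h.emb l, h.emb_mem_support l⟩ : Function.support s))
    fun _ _ h' => h.emb.injective (Subtype.mk.inj h')

/-- The point of the resolution given by a weighted family of chains. -/
noncomputable def weightedPoint (γ : (G.conf n).NerveSimplex k) (v : A → G.NerveSimplex k)
    (t : stdSimplex ℝ (Fin (k + 1))) (s : A → ℝ) (h : IsWeight γ v s) : G.Resolution n :=
  resMk γ (v ∘ h.emb) h.isFree_emb t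
    (normalize (s ∘ h.emb) (fun _ => h.nonneg _) (h.exists_pos_of_range h.eq_zero_of_notMem_range))

/-- A weighted point may be computed on any finite free subfamily which carries all weights. -/
theorem weightedPoint_eq (t : stdSimplex ℝ (Fin (k + 1))) (h : IsWeight γ v s) {i : ℕ}
    (θ : Fin (i + 1) ↪o A) (hθ : ∀ a ∉ Set.range θ, s a = 0) (hf : γ.IsFree (v ∘ θ)) :
    weightedPoint γ v t s h = resMk γ (v ∘ θ) hf t
      (normalize (s ∘ θ) (fun _ => h.nonneg _) (h.exists_pos_of_range hθ)) := by
  -- The sorted enumeration of the support factors through `θ` by an order embedding, so the two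
  -- points differ by one face gluing; the omitted vertices have weight zero.
  have hr (l) : ∃ l', θ l' = h.emb l := by
    by_contra hl
    have : h.emb l ∈ Function.support s := h.emb_mem_support l
    exact this (hθ _ hl)
  choose f hf' using hr
  let θ' : Fin ((h.finite.toFinset.card - 1) + 1) ↪o Fin (i + 1) :=
    OrderEmbedding.ofMapLEIff f fun a b => by rw [← θ.le_iff_le, hf', hf', h.emb.le_iff_le]
  have hcomp : θ ∘ θ' = h.emb := funext hf'
  refine resMk_comp θ' hf h.isFree_emb (by rw [Function.comp_assoc, hcomp]) t ?_
  rw [← map_normalize θ'.injective (s := s ∘ θ)]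
  · simp only [Function.comp_assoc, hcomp]
  · intro l hl
    by_contra hne
    have : θ l ∈ Set.range h.emb := by rw [h.range_emb]; exact hne
    obtain ⟨l', hl'⟩ := this
    exact hl ⟨l', θ.injective (by rw [← hl', ← hf']; rfl)⟩
  · intro l
    rw [Function.comp_assoc, hcomp]
    exact h.nonneg _
  · rw [Function.comp_assoc, hcomp]
    exact h.exists_pos_of_range h.eq_zero_of_notMem_range

theorem weightedPoint_comp (t : stdSimplex ℝ (Fin (k + 1))) (h : IsWeight γ v s) (θ : A' ↪o A)
    (hθ : ∀ a ∉ Set.range θ, s a = 0) {v' : A' → G.NerveSimplex k} {s' : A' → ℝ}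
    (h' : IsWeight γ v' s') (hv : v' = v ∘ θ) (hs : s' = s ∘ θ) :
    weightedPoint γ v' t s' h' = weightedPoint γ v t s h := by
  subst hv hs
  refine (weightedPoint_eq t h (h'.emb.trans θ) (fun a ha => ?_) h'.isFree_emb).symm
  by_cases har : a ∈ Set.range θ
  · obtain ⟨a, rfl⟩ := har
    exact h'.eq_zero_of_notMem_range a fun ⟨l, hl⟩ => ha ⟨l, congrArg θ hl⟩
  · exact hθ a har

theorem weightedPoint_reindex {m : ℕ} (θ : Fin (m + 1) →o Fin (k + 1))
    (t : stdSimplex ℝ (Fin (m + 1))) (h : IsWeight γ v s)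
    (h' : IsWeight (γ.reindex θ) (fun a => (v a).reindex θ) s) :
    weightedPoint (γ.reindex θ) (fun a => (v a).reindex θ) t s h' =
      weightedPoint γ v (stdSimplex.map θ t) s h :=
  resMk'_reindex θ (γ.join (v ∘ h.emb) h.isFree_emb) t _

end

/-! ### Openness of freeness and continuity of weighted points -/

/-- Freeness is preserved near a point. -/
theorem eventually_isFree (hL : IsClosed (Set.ofPred fun p : G.Ob × G.Ob => G.Linked p.1 p.2))
    {Z : Type*} [TopologicalSpace Z] {k : ℕ} {B : Type*} [Finite B]
    {γ : Z → (G.conf n).NerveSimplex k} {v : Z → B → G.NerveSimplex k}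
    (hγ : Continuous γ) (hv : ∀ l, Continuous fun z => v z l)
    (ho : ∀ z l c, ¬ G.IsOrbifoldPoint ((v z l).ob c)) {z₀ : Z} (h : (γ z₀).IsFree (v z₀)) :
    ∀ᶠ z in 𝓝 z₀, (γ z).IsFree (v z) := by
  have hob (c l) : Continuous fun z => (v z l).ob c := (continuous_nerve_ob _ c).comp (hv l)
  refine Filter.eventually_all.2 fun c => ?_
  have h1 : ∀ᶠ z in 𝓝 z₀, ∀ l, ¬ ∃ x ∈ ((γ z).ob c).1, G.Linked x ((v z l).ob c) := by
    refine Filter.eventually_all.2 fun l => ?_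
    have hc : Continuous fun z => ((γ z).ob c, (v z l).ob c) :=
      ((continuous_nerve_ob _ c).comp hγ).prodMk (hob c l)
    refine hc.continuousAt.eventually
      ((isClosed_exists_mem_linked hL).isOpen_compl.mem_nhds ?_)
    rintro ⟨x, hx, hxl⟩
    exact (h c).1 l x hx hxl
  have h2 : ∀ᶠ z in 𝓝 z₀, ∀ l l', l ≠ l' → ¬ G.Linked ((v z l).ob c) ((v z l').ob c) := by
    refine Filter.eventually_all.2 fun l => Filter.eventually_all.2 fun l' => ?_
    by_cases hll : l = l'
    · exact Filter.Eventually.of_forall fun z h => absurd hll h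
    have hc : Continuous fun z => ((v z l).ob c, (v z l').ob c) := (hob c l).prodMk (hob c l')
    filter_upwards [hc.continuousAt.eventually (hL.isOpen_compl.mem_nhds ((h c).2 hll))]
      with z hz _ using hz
  filter_upwards [h1, h2] with z h1 h2
  exact ⟨fun l x hx hxl => h1 l ⟨x, hx, hxl⟩, fun l l' => h2 l l', fun l => ho z l c⟩

/-- The support of the weights jumps, so the point is computed near `z₀` on a fixed finite family
`J` carrying all weights. Chains of `J` may have weight zero at `z₀`, which is why freeness at `z₀`
is required of all of `J` and not only of the support. -/
theorem continuous_weightedPoint [LinearOrder A]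
    (hL : IsClosed (Set.ofPred fun p : G.Ob × G.Ob => G.Linked p.1 p.2))
    {Z : Type*} [TopologicalSpace Z] {k : ℕ}
    {γ : Z → (G.conf n).NerveSimplex k} {v : Z → A → G.NerveSimplex k}
    {t : Z → stdSimplex ℝ (Fin (k + 1))} {s : Z → A → ℝ}
    (hγ : Continuous γ) (hv : ∀ a, Continuous fun z => v z a) (ht : Continuous t)
    (hs : ∀ a, Continuous fun z => s z a) (ho : ∀ z a c, ¬ G.IsOrbifoldPoint ((v z a).ob c))
    (h : ∀ z, IsWeight (γ z) (v z) (s z))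
    (hloc : ∀ z₀, ∃ J : Finset A, (∀ᶠ z in 𝓝 z₀, ∀ a ∉ J, s z a = 0) ∧
      (γ z₀).IsFree fun a : J => v z₀ a) :
    Continuous fun z => weightedPoint (γ z) (v z) (t z) (s z) (h z) := by
  refine continuous_iff_continuousAt.2 fun z₀ => ?_
  obtain ⟨J, hJ, hfree⟩ := hloc z₀
  have hcard : J.card = (J.card - 1) + 1 := by
    obtain ⟨a, ha⟩ := (h z₀).exists_pos
    have : 0 < J.card := Finset.card_pos.2 ⟨a, by
      by_contra haJ
      exact ha.ne' (hJ.self_of_nhds a haJ)⟩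
    omega
  let θ := J.orderEmbOfFin hcard
  have hr (a) : a ∉ Set.range θ ↔ a ∉ J := by
    rw [Finset.range_orderEmbOfFin]; rfl
  have hθ : (γ z₀).IsFree (v z₀ ∘ θ) :=
    hfree.comp (θ := fun l => (⟨θ l, J.orderEmbOfFin_mem hcard l⟩ : J)) fun _ _ h' =>
      θ.injective (congrArg Subtype.val h')
  obtain ⟨O, hO, hOo, hz₀⟩ := eventually_nhds_iff.1 (hJ.and (eventually_isFree hL
    (v := fun z => v z ∘ θ) hγ (fun l => hv _) (fun z l c => ho z _ c) hθ))
  have hθO (z : O) : ∀ a ∉ Set.range θ, s z a = 0 := fun a ha => (hO z z.2).1 a ((hr a).1 ha)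
  refine ContinuousOn.continuousAt (s := O) ?_ (hOo.mem_nhds hz₀)
  rw [continuousOn_iff_continuous_domRestrict]
  have hcont : Continuous fun z : O => resMk (γ z) (v z ∘ θ) (hO z z.2).2 (t z)
      (normalize (s z ∘ θ) (fun _ => (h z).nonneg _) ((h z).exists_pos_of_range (hθO z))) := by
    refine continuous_resMk'.comp (Continuous.prodMk ?_ (Continuous.prodMk ?_ ?_))
    · exact NerveSimplex.continuous_join (v := fun z : O => v z ∘ θ)
        (hγ.comp continuous_subtype_val) (fun l => (hv _).comp continuous_subtype_val)
        fun z => (hO z z.2).2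
    · exact ht.comp continuous_subtype_val
    · exact continuous_normalize (s := fun z : O => s z ∘ θ)
        (fun l => (hs _).comp continuous_subtype_val)
        (fun z _ => (h z).nonneg _) fun z => (h z).exists_pos_of_range (hθO z)
  convert hcont using 2 with z
  exact weightedPoint_eq (t z) (h z) θ (hθO z) _

end TopGroupoid

namespace TopGroupoid

variable {G : TopGroupoid.{u}} {n : ℕ}

/-! ### Weights avoiding a configuration -/

/-- The constant chain. -/
def NerveSimplex.const {k : ℕ} (x : G.Ob) : G.NerveSimplex k where
  ob _ := x
  ar _ _ _ := G.one x
  src_ar _ _ _ := G.src_one x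
  tgt_ar _ _ _ := G.tgt_one x
  ar_refl _ := rfl
  ar_trans _ _ _ _ _ := by
    have h := G.one_comp (G.one x)
    rw [G.comp_congr (congrArg G.one (G.src_one x)) rfl] at h
    exact h.symm

theorem ConfOb.isOpen_exists_mem {O : Set G.Ob} (hO : IsOpen O) :
    IsOpen (Set.ofPred fun S : G.ConfOb n => ∃ x ∈ S.1, x ∈ O) := by
  rw [← OrdConf.isQuotientMap_forget.isOpen_preimage]
  have : OrdConf.forget ⁻¹' (Set.ofPred fun S : G.ConfOb n => ∃ x ∈ S.1, x ∈ O) =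
      ⋃ i, Set.ofPred fun x : G.OrdConf n => x.1 i ∈ O := by
    ext x
    simp [OrdConf.forget]
  rw [this]
  exact isOpen_iUnion fun i => hO.preimage ((continuous_apply i).comp continuous_subtype_val)

theorem ConfOb.card_toFinset (S : G.ConfOb n) : S.finite.toFinset.card = n := by
  have h := S.2.1
  rw [S.finite.encard_eq_coe_toFinset_card] at h
  exact_mod_cast h

namespace SeparatedPoints

variable (w : G.SeparatedPoints)

/-- The function vanishes on an open set around a point of `S` linked to `w.pt a`, and every
configuration near `S` has a point in that open set. -/
theorem eventually_prod_eq_zero {S : G.ConfOb n} {a : ℕ} (h : ∃ x ∈ S.1, G.Linked x (w.pt a)) :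
    ∀ᶠ S' in 𝓝 S, S'.prod (w.bump a) = 0 := by
  obtain ⟨x, hx, hxa⟩ := h
  obtain ⟨O, hO, hOo, hxO⟩ := eventually_nhds_iff.1 (w.bump_eventually a hxa)
  refine Filter.eventually_of_mem ((ConfOb.isOpen_exists_mem hOo).mem_nhds ⟨x, hx, hxO⟩) ?_
  rintro S' ⟨y, hy, hyO⟩
  exact (S'.prod_eq_zero_iff _).2 ⟨y, hy, hO y hyO⟩

/-- Finitely many points avoid the zero set of one of the first functions. -/
theorem exists_le_card {ι : Type*} (T : Finset ι) (p : ι → G.Ob) :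
    ∃ a ≤ T.card, ∀ j ∈ T, 0 < w.bump a (p j) := by
  by_contra! h
  -- Otherwise `T.card + 1` functions each vanish at one of the `T.card` points, and two of them
  -- share a zero.
  have h' (a : ℕ) (ha : a ∈ Finset.range (T.card + 1)) : ∃ j ∈ T, w.bump a (p j) = 0 := by
    obtain ⟨j, hj, hj'⟩ := h a (Nat.lt_succ_iff.1 (Finset.mem_range.1 ha))
    exact ⟨j, hj, le_antisymm hj' (w.bump_nonneg _ _)⟩
  have : Nonempty ι := ⟨(h' 0 (by simp)).choose⟩
  choose! f hf using h'
  obtain ⟨a, ha, b, hb, hab, hfab⟩ := Finset.exists_ne_map_eq_of_card_lt_of_maps_to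
    (by simp : T.card < (Finset.range (T.card + 1)).card) (f := f)
    fun a ha => (hf a (Finset.mem_coe.1 ha)).1
  exact hab (w.eq_of_bump (hf a ha).2 (hfab ▸ (hf b hb).2))

theorem prod_nonneg (S : G.ConfOb n) (a : ℕ) : 0 ≤ S.prod (w.bump a) :=
  S.prod_nonneg (w.bump_nonneg a)

theorem prod_pos {S : G.ConfOb n} {a : ℕ} (h : ∀ x ∈ S.1, 0 < w.bump a x) :
    0 < S.prod (w.bump a) := by
  refine lt_of_le_of_ne (w.prod_nonneg S a) fun h0 => ?_
  obtain ⟨x, hx, hx0⟩ := (S.prod_eq_zero_iff _).1 h0.symm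
  exact (h x hx).ne' hx0

variable [T2Space G.Ob]

/-- The first configuration of a chain. -/
def _root_.TopGroupoid.NerveSimplex.start {k : ℕ} (γ : (G.conf n).NerveSimplex k) : G.ConfOb n :=
  γ.ob 0

theorem _root_.TopGroupoid.NerveSimplex.continuous_start {k : ℕ} :
    Continuous (NerveSimplex.start : (G.conf n).NerveSimplex k → _) :=
  continuous_nerve_ob _ 0

/-- Meeting the orbit of a given point is a property of the whole chain; it is enough to avoid that
orbit at object `0`. -/
theorem _root_.TopGroupoid.NerveSimplex.exists_mem_linked {k : ℕ} (γ : (G.conf n).NerveSimplex k)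
    (c e : Fin (k + 1)) {x : G.Ob} (h : ∃ y ∈ (γ.ob c).1, G.Linked y x) :
    ∃ y ∈ (γ.ob e).1, G.Linked y x := by
  obtain ⟨A, h1, h2⟩ := γ.linked c e
  obtain ⟨y, hy, hyx⟩ := h
  rw [← h1] at hy
  obtain ⟨f, hf, rfl⟩ := hy
  refine ⟨G.tgt f, ?_, G.linked_trans (G.linked_symm (G.linked_src_tgt f)) hyx⟩
  rw [← h2]
  exact ⟨f, hf, rfl⟩

/-- Weights on the separated points which avoid a chain of configurations. -/
noncomputable def baseWeight {k : ℕ} (γ : (G.conf n).NerveSimplex k) (a : ℕ) : ℝ :=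
  -- The factor `3` and the cut-off at `n + 2` are the values at `τ = 1` of the corresponding
  -- factors of `newWeight`.
  3 * γ.start.prod (w.bump a) * max 0 ((n : ℝ) + 2 - a)

/-- The constant chains at the separated points. -/
def chain (k a : ℕ) : G.NerveSimplex k := NerveSimplex.const (w.pt a)

theorem baseWeight_eq_zero {k : ℕ} (γ : (G.conf n).NerveSimplex k) {a : ℕ}
    (ha : a ∉ Finset.range (n + 2)) : w.baseWeight γ a = 0 := by
  have : ((n + 2 : ℕ) : ℝ) ≤ a := by exact_mod_cast not_lt.1 fun h => ha (Finset.mem_range.2 h)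
  push_cast at this
  rw [baseWeight, max_eq_left (by linarith), mul_zero]

theorem isFree_chain {k : ℕ} {γ : (G.conf n).NerveSimplex k} {J : Set ℕ}
    (hJ : ∀ a ∈ J, ¬ ∃ x ∈ γ.start.1, G.Linked x (w.pt a)) :
    γ.IsFree fun a : J => w.chain k a :=
  fun c => ⟨fun a x hx hxa => hJ a a.2 (γ.exists_mem_linked c 0 ⟨x, hx, hxa⟩),
    fun _ _ hab h => hab (Subtype.ext (w.eq_of_linked h)), fun a => w.not_isOrbifoldPoint a⟩

theorem isWeight_baseWeight {k : ℕ} (γ : (G.conf n).NerveSimplex k) :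
    IsWeight γ (w.chain k) (w.baseWeight γ) where
  nonneg a := mul_nonneg (mul_nonneg (by norm_num) (w.prod_nonneg _ a)) (le_max_left _ _)
  finite := (Finset.range (n + 2)).finite_toSet.subset fun a ha => by
    by_contra h
    exact ha (w.baseWeight_eq_zero γ h)
  exists_pos := by
    obtain ⟨a, ha, h⟩ := w.exists_le_card (γ.start.finite).toFinset id
    rw [ConfOb.card_toFinset] at ha
    have ha' : (a : ℝ) ≤ n := by exact_mod_cast ha
    refine ⟨a, mul_pos (mul_pos (by norm_num) (w.prod_pos fun x hx => h x (by simpa using hx))) ?_⟩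
    exact lt_max_of_lt_right (by linarith)
  isFree := w.isFree_chain fun a ha hx => ha (by
    rw [baseWeight, (w.eventually_prod_eq_zero hx).self_of_nhds, mul_zero, zero_mul])

/-- A section of the augmentation, on simplices. -/
noncomputable def sectionPoint {k : ℕ} (γ : (G.conf n).NerveSimplex k)
    (t : stdSimplex ℝ (Fin (k + 1))) : G.Resolution n :=
  weightedPoint γ (w.chain k) t (w.baseWeight γ) (w.isWeight_baseWeight γ)

theorem baseWeight_reindex {k m : ℕ} (θ : Fin (k + 1) →o Fin (m + 1))
    (γ : (G.conf n).NerveSimplex m) : w.baseWeight (γ.reindex θ) = w.baseWeight γ := by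
  funext a
  rw [baseWeight, baseWeight]
  congr 2
  exact γ.prod_ob_eq _ _ (w.bump_congr a)

theorem sectionPoint_reindex {k m : ℕ} (θ : Fin (k + 1) →o Fin (m + 1))
    (γ : (G.conf n).NerveSimplex m) (t : stdSimplex ℝ (Fin (k + 1))) :
    w.sectionPoint (γ.reindex θ) t = w.sectionPoint γ (stdSimplex.map θ t) := by
  rw [sectionPoint, sectionPoint, ← weightedPoint_reindex θ t (w.isWeight_baseWeight γ)
    (w.baseWeight_reindex θ γ ▸ w.isWeight_baseWeight (γ.reindex θ))]
  congr 1
  exact w.baseWeight_reindex θ γ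

theorem continuous_sectionPoint
    (hL : IsClosed (Set.ofPred fun p : G.Ob × G.Ob => G.Linked p.1 p.2)) {k : ℕ} :
    Continuous fun p : (G.conf n).NerveSimplex k × stdSimplex ℝ (Fin (k + 1)) =>
      w.sectionPoint p.1 p.2 := by
  have hc : Continuous fun p : (G.conf n).NerveSimplex k × stdSimplex ℝ (Fin (k + 1)) =>
      p.1.start := NerveSimplex.continuous_start.comp continuous_fst
  refine continuous_weightedPoint hL (v := fun _ => w.chain k) continuous_fst
    (fun a => continuous_const) continuous_snd (fun a => ?_) (fun _ a _ => w.not_isOrbifoldPoint a)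
    _ fun z₀ => ?_
  · exact (continuous_const.mul ((ConfOb.continuous_prod (w.continuous_bump a)).comp hc)).mul
      continuous_const
  · classical
    -- The separated points linked to the configuration at `z₀` are discarded; their weights vanish
    -- in a neighbourhood.
    refine ⟨(Finset.range (n + 2)).filter fun a =>
      ¬ ∃ x ∈ z₀.1.start.1, G.Linked x (w.pt a), ?_, ?_⟩
    · have : ∀ᶠ z in 𝓝 z₀, ∀ a ∈ Finset.range (n + 2),
          (∃ x ∈ z₀.1.start.1, G.Linked x (w.pt a)) → w.baseWeight z.1 a = 0 := by
        refine (Filter.eventually_all_finset _).2 fun a _ => ?_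
        by_cases hx : ∃ x ∈ z₀.1.start.1, G.Linked x (w.pt a)
        · filter_upwards [hc.continuousAt.eventually (w.eventually_prod_eq_zero hx)] with z hz _
          rw [baseWeight, hz, mul_zero, zero_mul]
        · exact Filter.Eventually.of_forall fun z h => absurd h hx
      filter_upwards [this] with z hz a ha
      by_cases har : a ∈ Finset.range (n + 2)
      · refine hz a har ?_
        by_contra h
        exact ha (Finset.mem_filter.2 ⟨har, h⟩)
      · exact w.baseWeight_eq_zero _ har
    · exact w.isFree_chain (J := (Finset.filter _ _ : Finset ℕ)) fun a ha =>
        (Finset.mem_filter.1 ha).2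

end SeparatedPoints

end TopGroupoid

namespace TopGroupoid

/-! ### Sliding to the section -/

/-- The largest barycentric coordinate. -/
noncomputable def maxWeight {i : ℕ} (s : stdSimplex ℝ (Fin (i + 1))) : ℝ :=
  Finset.univ.sup' Finset.univ_nonempty fun l => s l

section
variable {i : ℕ} (s : stdSimplex ℝ (Fin (i + 1)))

theorem le_maxWeight (l : Fin (i + 1)) : s l ≤ maxWeight s :=
  Finset.le_sup' (fun l => s l) (Finset.mem_univ l)

theorem exists_eq_maxWeight : ∃ l, maxWeight s = s l := by
  obtain ⟨l, -, h⟩ := Finset.exists_mem_eq_sup' Finset.univ_nonempty fun l => s l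
  exact ⟨l, h⟩

theorem maxWeight_pos : 0 < maxWeight s := by
  by_contra! h
  have : ∑ l, s l = 0 := Finset.sum_eq_zero fun l _ =>
    le_antisymm ((le_maxWeight s l).trans h) (stdSimplex.zero_le s l)
  rw [stdSimplex.sum_eq_one] at this
  exact one_ne_zero this

theorem continuous_coord (l : Fin (i + 1)) :
    Continuous fun s : stdSimplex ℝ (Fin (i + 1)) => s l :=
  (continuous_apply l).comp continuous_subtype_val

theorem continuous_maxWeight :
    Continuous (maxWeight : stdSimplex ℝ (Fin (i + 1)) → ℝ) :=
  Continuous.finset_sup'_apply Finset.univ_nonempty fun l _ => continuous_coord l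

/-- The largest coordinate does not see zero coordinates, so thresholds measured against it respect
the face gluings. -/
theorem maxWeight_map {j : ℕ} {θ : Fin (i + 1) → Fin (j + 1)} (hθ : θ.Injective) :
    maxWeight (stdSimplex.map θ s) = maxWeight s := by
  refine le_antisymm ?_ ?_
  · obtain ⟨l, hl⟩ := exists_eq_maxWeight (stdSimplex.map θ s)
    rw [hl]
    by_cases h : l ∈ Set.range θ
    · obtain ⟨l, rfl⟩ := h
      rw [map_apply_of_injective hθ]
      exact le_maxWeight s l
    · rw [map_apply_of_notMem s h]
      exact (maxWeight_pos s).le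
  · obtain ⟨l, hl⟩ := exists_eq_maxWeight s
    rw [hl, ← map_apply_of_injective hθ]
    exact le_maxWeight _ _

/-- Few coordinates are large. -/
theorem card_large_le :
    (((Finset.univ.filter fun l => maxWeight s ≤ 3 * s l).card : ℕ) : ℝ) ≤ 3 / maxWeight s := by
  have hm := maxWeight_pos s
  rw [le_div_iff₀ hm]
  calc ((Finset.univ.filter fun l => maxWeight s ≤ 3 * s l).card : ℝ) * maxWeight s
      = ∑ l ∈ Finset.univ.filter fun l => maxWeight s ≤ 3 * s l, maxWeight s := by simp
    _ ≤ ∑ l ∈ Finset.univ.filter fun l => maxWeight s ≤ 3 * s l, 3 * s l :=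
        Finset.sum_le_sum fun l hl => (Finset.mem_filter.1 hl).2
    _ ≤ ∑ l, 3 * s l := Finset.sum_le_sum_of_subset_of_nonneg (Finset.subset_univ _)
        fun l _ _ => mul_nonneg (by norm_num) (stdSimplex.zero_le s l)
    _ = 3 := by rw [← Finset.mul_sum, stdSimplex.sum_eq_one, mul_one]

end

open scoped unitInterval

variable {G : TopGroupoid.{u}} {n : ℕ} [T2Space G.Ob]

namespace SeparatedPoints

variable (w : G.SeparatedPoints) {k i : ℕ}

/-- A factor which vanishes when the `a`-th separated point is close to an extra point of large
weight, as long as the parameter is at most `3 / 4`. -/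
noncomputable def clearance (x : (G.confResolution n i).NerveSimplex k)
    (s : stdSimplex ℝ (Fin (i + 1))) (τ : I) (a : ℕ) : ℝ :=
  -- A factor is `1` when `s l = 0` (needed for faces) and positive when `3 s l < maxWeight s`. The
  -- term `4 τ - 3` makes every factor positive after `τ = 3/4` and equal to `1` at `τ = 1`.
  ∏ l, max (w.bump a ((x.vertex l).ob 0)) (max (1 - 3 * s l / maxWeight s) (4 * τ - 3))

/-- The weights of the separated points during the homotopy. -/
noncomputable def newWeight (x : (G.confResolution n i).NerveSimplex k)
    (s : stdSimplex ℝ (Fin (i + 1))) (τ : I) (a : ℕ) : ℝ :=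
  -- The first factor is zero until `τ = 1/4`. The moving cut-off admits at least `4 / maxWeight s`
  -- extra candidates while `τ ≤ 3/4`, more than the large coordinates can block, and returns to `n
  -- + 2` at `τ = 1`.
  max 0 (4 * τ - 1 : ℝ) * x.base.start.prod (w.bump a) * w.clearance x s τ a *
    max 0 ((n : ℝ) + 2 + 16 / maxWeight s * (1 - τ) - a)

/-- The weights of the given extra points during the homotopy. -/
noncomputable def oldWeight (s : stdSimplex ℝ (Fin (i + 1))) (τ : I) (l : Fin (i + 1)) : ℝ :=
  max 0 (s l - 2 * τ * maxWeight s)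

/-- All weights during the homotopy. -/
noncomputable def slideWeight (x : (G.confResolution n i).NerveSimplex k)
    (s : stdSimplex ℝ (Fin (i + 1))) (τ : I) (a : Fin (i + 1) ⊕ₗ ℕ) : ℝ :=
  Sum.elim (oldWeight s τ) (w.newWeight x s τ) (ofLex a)

/-- The given chains of extra points, followed by the constant chains at the separated points. -/
def slideChain (x : (G.confResolution n i).NerveSimplex k) (a : Fin (i + 1) ⊕ₗ ℕ) :
    G.NerveSimplex k :=
  Sum.elim x.vertex (w.chain k) (ofLex a)

/-- The indices of the chains which may have a positive weight near a given point. -/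
def active (x : (G.confResolution n i).NerveSimplex k)
    (s : stdSimplex ℝ (Fin (i + 1))) (τ : I) : Set (Fin (i + 1) ⊕ₗ ℕ) :=
  -- The inequalities are not strict: the set must contain every index whose weight is positive at
  -- parameters arbitrarily near the given one.
  Set.ofPred fun a => Sum.elim (fun l => 2 * τ * maxWeight s ≤ s l)
    (fun a => (1 : ℝ) ≤ 4 * τ ∧ (¬ ∃ y ∈ x.base.start.1, G.Linked y (w.pt a)) ∧
      ∀ l, 2 * τ * maxWeight s ≤ s l → ¬ G.Linked ((x.vertex l).ob 0) (w.pt a)) (ofLex a)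

/-- Old points are mutually free by assumption and new ones by separation. The mixed conditions are
imposed at object `0` and carried along the chains by their arrows. -/
theorem isFree_active (x : (G.confResolution n i).NerveSimplex k)
    (s : stdSimplex ℝ (Fin (i + 1))) (τ : I) :
    x.base.IsFree fun a : w.active x s τ => w.slideChain x a := by
  intro c
  have hx := x.isFree_vertex c
  refine ⟨?_, ?_, ?_⟩
  · rintro ⟨a, ha⟩ y hy
    obtain ⟨l | a, rfl⟩ := toLex.surjective a
    · exact hx.1 l y hy
    · exact fun h => ha.2.1 (x.base.exists_mem_linked c 0 ⟨y, hy, h⟩)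
  · rintro ⟨a, ha⟩ ⟨b, hb⟩ hab
    obtain ⟨l | a, rfl⟩ := toLex.surjective a <;> obtain ⟨l' | b, rfl⟩ := toLex.surjective b
    · exact hx.2 fun h => hab (by subst h; rfl)
    · exact fun h => hb.2.2 l ha (G.linked_trans ((x.vertex l).linked 0 c) h)
    · exact fun h => ha.2.2 l' hb (G.linked_trans ((x.vertex l').linked 0 c) (G.linked_symm h))
    · exact fun h => hab (by obtain rfl := w.eq_of_linked h; rfl)
  · rintro ⟨a, ha⟩
    obtain ⟨l | a, rfl⟩ := toLex.surjective a
    · exact hx.3 l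
    · exact w.not_isOrbifoldPoint a

theorem clearance_nonneg (x : (G.confResolution n i).NerveSimplex k)
    (s : stdSimplex ℝ (Fin (i + 1))) (τ : I) (a : ℕ) : 0 ≤ w.clearance x s τ a :=
  Finset.prod_nonneg fun _ _ => le_max_of_le_left (w.bump_nonneg _ _)

theorem slideWeight_nonneg (x : (G.confResolution n i).NerveSimplex k)
    (s : stdSimplex ℝ (Fin (i + 1))) (τ : I) (a) : 0 ≤ w.slideWeight x s τ a := by
  obtain ⟨l | a, rfl⟩ := toLex.surjective a
  · exact le_max_left _ _
  · exact mul_nonneg (mul_nonneg (mul_nonneg (le_max_left _ _) (w.prod_nonneg _ _))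
      (w.clearance_nonneg x s τ a)) (le_max_left _ _)

theorem newWeight_eq_zero (x : (G.confResolution n i).NerveSimplex k)
    (s : stdSimplex ℝ (Fin (i + 1))) (τ : I) {a : ℕ}
    (ha : (n : ℝ) + 2 + 16 / maxWeight s * (1 - τ) ≤ a) : w.newWeight x s τ a = 0 := by
  rw [newWeight, max_eq_left (sub_nonpos.2 ha), mul_zero]

/-- Before `τ = 1/2` the largest old weight survives. From `1/2` to `3/4`, pigeonhole over the
configuration and the large old points gives a new point; after `3/4` the configuration alone has to
be avoided. -/
theorem exists_slideWeight_pos (x : (G.confResolution n i).NerveSimplex k)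
    (s : stdSimplex ℝ (Fin (i + 1))) (τ : I) : ∃ a, 0 < w.slideWeight x s τ a := by
  have hm := maxWeight_pos s
  have hτ := τ.2.2
  rcases lt_or_ge (τ : ℝ) (1 / 2) with h | h
  · obtain ⟨l, hl⟩ := exists_eq_maxWeight s
    refine ⟨toLex (Sum.inl l), lt_max_of_lt_right ?_⟩
    rw [← hl]
    nlinarith
  classical
  have key (a : ℕ) (h1 : ∀ y ∈ x.base.start.1, 0 < w.bump a y) (h2 : 0 < w.clearance x s τ a)
      (h3 : (a : ℝ) < (n : ℝ) + 2 + 16 / maxWeight s * (1 - τ)) :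
      ∃ a, 0 < w.slideWeight x s τ a :=
    ⟨toLex (Sum.inr a), mul_pos (mul_pos (mul_pos (lt_max_of_lt_right (by linarith))
      (w.prod_pos h1)) h2) (lt_max_of_lt_right (sub_pos.2 h3))⟩
  rcases le_or_gt (τ : ℝ) (3 / 4) with h' | h'
  · obtain ⟨a, ha, hpos⟩ := w.exists_le_card (x.base.start.finite.toFinset.disjSum
      (Finset.univ.filter fun l => maxWeight s ≤ 3 * s l)) (Sum.elim id fun l => (x.vertex l).ob 0)
    refine key a (fun y hy => hpos (Sum.inl y) (by simpa using hy))
      (Finset.prod_pos fun l _ => ?_) ?_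
    · by_cases hl : maxWeight s ≤ 3 * s l
      · exact lt_max_of_lt_left (hpos (Sum.inr l) (by simpa using hl))
      · refine lt_max_of_lt_right (lt_max_of_lt_left ?_)
        rw [sub_pos, div_lt_one hm]
        exact not_le.1 hl
    · rw [Finset.card_disjSum, ConfOb.card_toFinset] at ha
      have ha' : (a : ℝ) ≤ n + (Finset.univ.filter fun l => maxWeight s ≤ 3 * s l).card := by
        exact_mod_cast ha
      have hc := card_large_le s
      -- The part `3 / maxWeight s` pays for the large old points; the rest is non-negative because
      -- `16 τ ≤ 12`.
      have h16 : 16 / maxWeight s * (1 - τ) = 3 / maxWeight s + (13 - 16 * τ) / maxWeight s := by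
        ring
      have : 0 ≤ (13 - 16 * τ) / maxWeight s := div_nonneg (by linarith) hm.le
      linarith
  · obtain ⟨a, ha, hpos⟩ := w.exists_le_card x.base.start.finite.toFinset id
    rw [ConfOb.card_toFinset] at ha
    have ha' : (a : ℝ) ≤ n := by exact_mod_cast ha
    refine key a (fun y hy => hpos y (by simpa using hy)) (Finset.prod_pos fun l _ =>
      lt_max_of_lt_right (lt_max_of_lt_right (by linarith))) ?_
    have : 0 ≤ 16 / maxWeight s * (1 - τ) :=
      mul_nonneg (div_nonneg (by norm_num) hm.le) (by linarith)
    linarith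

/-! ### Continuity of the homotopy on products of simplices -/

section
variable (n k i) in
/-- The parameters of the homotopy on a product of simplices. -/
abbrev SlideParam (G : TopGroupoid.{u}) [T2Space G.Ob] : Type u :=
  ((G.confResolution n i).NerveSimplex k × stdSimplex ℝ (Fin (k + 1)) ×
    stdSimplex ℝ (Fin (i + 1))) × I

theorem continuous_newWeight (a : ℕ) :
    Continuous fun z : SlideParam n k i G => w.newWeight z.1.1 z.1.2.2 z.2 a := by
  have hm : Continuous fun z : SlideParam n k i G => maxWeight z.1.2.2 :=
    continuous_maxWeight.comp (by fun_prop)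
  have hm0 (z : SlideParam n k i G) : maxWeight z.1.2.2 ≠ 0 := (maxWeight_pos _).ne'
  have hτ : Continuous fun z : SlideParam n k i G => (z.2 : ℝ) := by fun_prop
  have hp : Continuous fun z : SlideParam n k i G => z.1.1.base.start.prod (w.bump a) :=
    (ConfOb.continuous_prod (w.continuous_bump a)).comp (NerveSimplex.continuous_start.comp
      (NerveSimplex.continuous_base.comp (by fun_prop)))
  have hc : Continuous fun z : SlideParam n k i G => w.clearance z.1.1 z.1.2.2 z.2 a := by
    refine continuous_finsetProd _ fun l _ => Continuous.max ?_ (Continuous.max ?_ (by fun_prop))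
    · exact (w.continuous_bump a).comp ((continuous_nerve_ob _ 0).comp
        ((NerveSimplex.continuous_vertex l).comp (by fun_prop)))
    · exact continuous_const.sub ((continuous_const.mul ((continuous_coord l).comp
        (by fun_prop))).div hm hm0)
  refine ((Continuous.mul (by fun_prop) hp).mul hc).mul (continuous_const.max ?_)
  exact (continuous_const.add ((continuous_const.div hm hm0).mul (by fun_prop))).sub
    continuous_const

theorem continuous_oldWeight (l : Fin (i + 1)) :
    Continuous fun z : SlideParam n k i G => oldWeight z.1.2.2 z.2 l := by
  have hm : Continuous fun z : SlideParam n k i G => maxWeight z.1.2.2 :=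
    continuous_maxWeight.comp (by fun_prop)
  have hs : Continuous fun z : SlideParam n k i G => z.1.2.2 l :=
    (continuous_coord l).comp (by fun_prop)
  exact continuous_const.max (hs.sub (Continuous.mul (by fun_prop) hm))

/-- Each way of failing to be active is witnessed by a factor that vanishes on a neighbourhood. The
delicate case is a separated point linked to an old point that has not yet been removed, where the
clearance factor vanishes. -/
theorem eventually_slideWeight_eq_zero (z₀ : SlideParam n k i G) {a : Fin (i + 1) ⊕ₗ ℕ}
    (ha : a ∉ w.active z₀.1.1 z₀.1.2.2 z₀.2) :
    ∀ᶠ z in 𝓝 z₀, w.slideWeight z.1.1 z.1.2.2 z.2 a = 0 := by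
  have hm : Continuous fun z : SlideParam n k i G => maxWeight z.1.2.2 :=
    continuous_maxWeight.comp (by fun_prop)
  have hs (l) : Continuous fun z : SlideParam n k i G => z.1.2.2 l :=
    (continuous_coord l).comp (by fun_prop)
  have hτ : Continuous fun z : SlideParam n k i G => (z.2 : ℝ) := by fun_prop
  obtain ⟨l | a, rfl⟩ := toLex.surjective a
  · have ha' : z₀.1.2.2 l < 2 * z₀.2 * maxWeight z₀.1.2.2 := not_le.1 ha
    filter_upwards [(hs l).continuousAt.eventually_lt
      ((continuous_const.mul hτ).mul hm).continuousAt ha'] with z hz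
    exact max_eq_left (sub_nonpos.2 hz.le)
  have ha' : ¬ ((1 : ℝ) ≤ 4 * z₀.2 ∧ (¬ ∃ y ∈ z₀.1.1.base.start.1, G.Linked y (w.pt a)) ∧
      ∀ l, 2 * z₀.2 * maxWeight z₀.1.2.2 ≤ z₀.1.2.2 l →
        ¬ G.Linked ((z₀.1.1.vertex l).ob 0) (w.pt a)) := ha
  change ∀ᶠ z in 𝓝 z₀, w.newWeight z.1.1 z.1.2.2 z.2 a = 0
  by_cases h1 : (1 : ℝ) ≤ 4 * z₀.2
  swap
  · filter_upwards [(continuous_const.mul hτ).continuousAt.eventually_lt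
      continuousAt_const (not_le.1 h1)] with z hz
    have hz' : 4 * (z.2 : ℝ) - 1 ≤ 0 := sub_nonpos.2 (le_of_lt hz)
    rw [newWeight, max_eq_left hz', zero_mul, zero_mul, zero_mul]
  by_cases h2 : ∃ y ∈ z₀.1.1.base.start.1, G.Linked y (w.pt a)
  · have hc : Continuous fun z : SlideParam n k i G => z.1.1.base.start :=
      NerveSimplex.continuous_start.comp (NerveSimplex.continuous_base.comp (by fun_prop))
    filter_upwards [hc.continuousAt.eventually (w.eventually_prod_eq_zero h2)] with z hz
    rw [newWeight, hz, mul_zero, zero_mul, zero_mul]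
  obtain ⟨l, hl, hla⟩ : ∃ l, 2 * z₀.2 * maxWeight z₀.1.2.2 ≤ z₀.1.2.2 l ∧
      G.Linked ((z₀.1.1.vertex l).ob 0) (w.pt a) := by
    by_contra! h
    exact ha' ⟨h1, h2, h⟩
  have hm0 := maxWeight_pos z₀.1.2.2
  -- An old point with `2 τ M ≤ s l ≤ M` forces `τ ≤ 1/2`, and `τ ≥ 1/4` gives `s l ≥ M / 2`. The
  -- strict bounds `τ < 3/4` and `M < 3 s l` persist nearby and keep the clearance factor at zero.
  have hτ0 : (z₀.2 : ℝ) < 3 / 4 := by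
    have := le_maxWeight z₀.1.2.2 l
    nlinarith
  have hl0 : maxWeight z₀.1.2.2 < 3 * z₀.1.2.2 l := by nlinarith
  have hv : Continuous fun z : SlideParam n k i G => (z.1.1.vertex l).ob 0 :=
    (continuous_nerve_ob _ 0).comp ((NerveSimplex.continuous_vertex l).comp (by fun_prop))
  filter_upwards [hv.continuousAt.eventually (w.bump_eventually a hla),
    hτ.continuousAt.eventually_lt continuousAt_const hτ0,
    hm.continuousAt.eventually_lt (continuous_const.mul (hs l)).continuousAt hl0] with z hz1 hz2 hz3
  have : w.clearance z.1.1 z.1.2.2 z.2 a = 0 := by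
    refine Finset.prod_eq_zero (Finset.mem_univ l) ?_
    rw [hz1]
    refine max_eq_left (max_le ?_ (by linarith))
    rw [sub_nonpos, one_le_div (maxWeight_pos _)]
    exact hz3.le
  rw [newWeight, this, mul_zero, zero_mul]

theorem isWeight_slideWeight (x : (G.confResolution n i).NerveSimplex k)
    (s : stdSimplex ℝ (Fin (i + 1))) (τ : I) :
    IsWeight x.base (w.slideChain x) (w.slideWeight x s τ) where
  nonneg := w.slideWeight_nonneg x s τ
  finite := by
    obtain ⟨N, hN⟩ := exists_nat_gt ((n : ℝ) + 2 + 16 / maxWeight s * (1 - τ))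
    refine ((Set.finite_range fun l => toLex (Sum.inl l)).union
      ((Set.finite_lt_nat N).image fun a => toLex (Sum.inr a))).subset fun a ha => ?_
    obtain ⟨l | a, rfl⟩ := toLex.surjective a
    · exact Or.inl ⟨l, rfl⟩
    · refine Or.inr ⟨a, ?_, rfl⟩
      by_contra h
      have h' : (N : ℝ) ≤ a := by exact_mod_cast not_lt.1 h
      exact ha (w.newWeight_eq_zero x s τ (by linarith))
  exists_pos := w.exists_slideWeight_pos x s τ
  isFree := by
    have (a : Function.support (w.slideWeight x s τ)) : a.1 ∈ w.active x s τ := by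
      by_contra h
      -- The weights do not involve `t`; any point of the simplex completes the parameter.
      obtain ⟨t⟩ : Nonempty (stdSimplex ℝ (Fin (k + 1))) := inferInstance
      exact a.2 (w.eventually_slideWeight_eq_zero ((x, t, s), τ) h).self_of_nhds
    exact (w.isFree_active x s τ).comp (θ := fun a => ⟨a.1, this a⟩) fun a b h =>
      Subtype.ext (Subtype.mk.inj h)

/-- The homotopy from the identity to the section, on products of simplices. -/
noncomputable def slidePoint (x : (G.confResolution n i).NerveSimplex k)
    (t : stdSimplex ℝ (Fin (k + 1))) (s : stdSimplex ℝ (Fin (i + 1))) (τ : I) : G.Resolution n :=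
  weightedPoint x.base (w.slideChain x) t (w.slideWeight x s τ) (w.isWeight_slideWeight x s τ)

theorem continuous_slidePoint
    (hL : IsClosed (Set.ofPred fun p : G.Ob × G.Ob => G.Linked p.1 p.2)) :
    Continuous fun z : SlideParam n k i G => w.slidePoint z.1.1 z.1.2.1 z.1.2.2 z.2 := by
  classical
  refine continuous_weightedPoint hL (γ := fun z : SlideParam n k i G => z.1.1.base)
    (v := fun z => w.slideChain z.1.1) (NerveSimplex.continuous_base.comp (by fun_prop))
    (fun a => ?_) (by fun_prop) (fun a => ?_) (fun z a c => ?_) _ fun z₀ => ?_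
  · obtain ⟨l | a, rfl⟩ := toLex.surjective a
    · exact (NerveSimplex.continuous_vertex l).comp (by fun_prop)
    · exact continuous_const
  · obtain ⟨l | a, rfl⟩ := toLex.surjective a
    · exact continuous_oldWeight l
    · exact w.continuous_newWeight a
  · obtain ⟨l | a, rfl⟩ := toLex.surjective a
    · exact (z.1.1.isFree_vertex c).3 l
    · exact w.not_isOrbifoldPoint a
  · obtain ⟨N, hN⟩ := exists_nat_gt ((n : ℝ) + 2 + 16 / maxWeight z₀.1.2.2 * (1 - z₀.2))
    have hN' : ∀ᶠ z in 𝓝 z₀, (n : ℝ) + 2 + 16 / maxWeight z.1.2.2 * (1 - z.2) < N := by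
      have hm : Continuous fun z : SlideParam n k i G => maxWeight z.1.2.2 :=
        continuous_maxWeight.comp (by fun_prop)
      have hc : Continuous fun z : SlideParam n k i G =>
          (n : ℝ) + 2 + 16 / maxWeight z.1.2.2 * (1 - z.2) :=
        continuous_const.add ((continuous_const.div hm fun z => (maxWeight_pos _).ne').mul
          (by fun_prop))
      exact hc.continuousAt.eventually_lt continuousAt_const hN
    -- By continuity of the cut-off, `N` bounds the indices of new points uniformly near `z₀`, so
    -- only finitely many indices matter.
    let F : Finset (Fin (i + 1) ⊕ₗ ℕ) := (Finset.univ.disjSum (Finset.range N)).map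
      toLex.toEmbedding
    refine ⟨F.filter fun a => a ∈ w.active z₀.1.1 z₀.1.2.2 z₀.2, ?_, ?_⟩
    · have : ∀ᶠ z in 𝓝 z₀, ∀ a ∈ F, a ∉ w.active z₀.1.1 z₀.1.2.2 z₀.2 →
          w.slideWeight z.1.1 z.1.2.2 z.2 a = 0 := by
        refine (Filter.eventually_all_finset _).2 fun a _ => ?_
        by_cases ha : a ∈ w.active z₀.1.1 z₀.1.2.2 z₀.2
        · exact Filter.Eventually.of_forall fun z h => absurd ha h
        · filter_upwards [w.eventually_slideWeight_eq_zero z₀ ha] with z hz _ using hz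
      filter_upwards [this, hN'] with z hz hzN a ha
      by_cases haF : a ∈ F
      · exact hz a haF fun h => ha (Finset.mem_filter.2 ⟨haF, h⟩)
      · obtain ⟨l | a, rfl⟩ := toLex.surjective a
        · exact absurd (by simp [F]) haF
        · have h' : N ≤ a := by
            by_contra h
            exact haF (by simpa [F] using h)
          have h'' : (N : ℝ) ≤ a := by exact_mod_cast h'
          exact w.newWeight_eq_zero _ _ _ (by linarith)
    · exact (w.isFree_active z₀.1.1 z₀.1.2.2 z₀.2).comp
        (θ := fun a : {a // a ∈ F.filter fun a => a ∈ w.active z₀.1.1 z₀.1.2.2 z₀.2} =>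
          (⟨a.1, (Finset.mem_filter.1 a.2).2⟩ : w.active z₀.1.1 z₀.1.2.2 z₀.2))
        fun a b h => Subtype.ext (congrArg (fun y : w.active z₀.1.1 z₀.1.2.2 z₀.2 => y.1) h)

end

/-! ### End points of the homotopy and compatibility with the gluing relations -/

theorem slidePoint_zero (x : (G.confResolution n i).NerveSimplex k)
    (t : stdSimplex ℝ (Fin (k + 1))) (s : stdSimplex ℝ (Fin (i + 1))) :
    w.slidePoint x t s 0 = resMk' x t s := by
  let θ : Fin (i + 1) ↪o Fin (i + 1) ⊕ₗ ℕ :=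
    OrderEmbedding.ofMapLEIff (fun l => toLex (Sum.inl l)) fun _ _ => Sum.Lex.inl_le_inl_iff
  have hs : w.slideWeight x s 0 ∘ θ = s := funext fun l => by
    change max 0 (s l - 2 * (0 : ℝ) * maxWeight s) = s l
    rw [mul_zero, zero_mul, sub_zero, max_eq_right (stdSimplex.zero_le s l)]
  refine (weightedPoint_eq t (w.isWeight_slideWeight x s 0) θ (fun a ha => ?_)
    x.isFree_vertex).trans ?_
  · obtain ⟨l | a, rfl⟩ := toLex.surjective a
    · exact absurd ⟨l, rfl⟩ ha
    · change w.newWeight x s 0 a = 0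
      have : max 0 (4 * ((0 : I) : ℝ) - 1) = 0 := by
        rw [Set.Icc.coe_zero]; norm_num
      rw [newWeight, this, zero_mul, zero_mul, zero_mul]
  · refine congrArg (resMk' x t) ?_
    simp only [hs]
    exact normalize_coe s _ _

theorem slidePoint_one (x : (G.confResolution n i).NerveSimplex k)
    (t : stdSimplex ℝ (Fin (k + 1))) (s : stdSimplex ℝ (Fin (i + 1))) :
    w.slidePoint x t s 1 = w.sectionPoint x.base t := by
  let θ : ℕ ↪o Fin (i + 1) ⊕ₗ ℕ :=
    OrderEmbedding.ofMapLEIff (fun l => toLex (Sum.inr l)) fun _ _ => Sum.Lex.inr_le_inr_iff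
  refine (weightedPoint_comp t (w.isWeight_slideWeight x s 1) θ (fun a ha => ?_)
    (w.isWeight_baseWeight x.base) rfl (funext fun a => ?_)).symm
  · obtain ⟨l | a, rfl⟩ := toLex.surjective a
    · change max 0 (s l - 2 * (1 : ℝ) * maxWeight s) = 0
      have := le_maxWeight s l
      have := maxWeight_pos s
      exact max_eq_left (by linarith)
    · exact absurd ⟨a, rfl⟩ ha
  · change w.baseWeight x.base a = w.newWeight x s 1 a
    have h1 : max 0 (4 * ((1 : I) : ℝ) - 1) = 3 := by
      rw [Set.Icc.coe_one]; norm_num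
    have h2 : w.clearance x s 1 a = 1 := by
      refine Finset.prod_eq_one fun l _ => ?_
      have : 0 ≤ 3 * s l / maxWeight s :=
        div_nonneg (mul_nonneg (by norm_num) (stdSimplex.zero_le s l)) (maxWeight_pos s).le
      rw [Set.Icc.coe_one, max_eq_right (a := 1 - 3 * s l / maxWeight s) (by linarith),
        max_eq_right (by linarith [w.bump_le_one a ((x.vertex l).ob 0)])]
      norm_num
    rw [baseWeight, newWeight, h1, h2, Set.Icc.coe_one, sub_self, mul_zero, add_zero, mul_one]

/-- Reindexing changes which object is number `0`, but the functions `w.bump a` are invariant along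
the chains. -/
theorem slidePoint_reindex {m : ℕ} (θ : Fin (k + 1) →o Fin (m + 1))
    (x : (G.confResolution n i).NerveSimplex m) (t : stdSimplex ℝ (Fin (k + 1)))
    (s : stdSimplex ℝ (Fin (i + 1))) (τ : I) :
    w.slidePoint (x.reindex θ) t s τ = w.slidePoint x (stdSimplex.map θ t) s τ := by
  have hw : w.slideWeight (x.reindex θ) s τ = w.slideWeight x s τ := by
    funext a
    obtain ⟨l | a, rfl⟩ := toLex.surjective a
    · rfl
    · change w.newWeight (x.reindex θ) s τ a = w.newWeight x s τ a
      have h1 : (x.reindex θ).base.start.prod (w.bump a) = x.base.start.prod (w.bump a) :=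
        x.base.prod_ob_eq _ _ (w.bump_congr a)
      have h2 : w.clearance (x.reindex θ) s τ a = w.clearance x s τ a := by
        refine Finset.prod_congr rfl fun l _ => ?_
        have : w.bump a (((x.reindex θ).vertex l).ob 0) = w.bump a ((x.vertex l).ob 0) :=
          w.bump_congr a ((x.vertex l).linked (θ 0) 0)
        rw [this]
      rw [newWeight, newWeight, h1, h2]
  have hc : w.slideChain (x.reindex θ) = fun a => (w.slideChain x a).reindex θ := by
    funext a
    obtain ⟨l | a, rfl⟩ := toLex.surjective a <;> rfl
  have h' : IsWeight (x.base.reindex θ) (fun a => (w.slideChain x a).reindex θ)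
      (w.slideWeight x s τ) := by
    rw [← hw, ← hc]
    exact w.isWeight_slideWeight (x.reindex θ) s τ
  refine Eq.trans ?_ (weightedPoint_reindex θ t (w.isWeight_slideWeight x s τ) h')
  rw [slidePoint]
  congr 1

theorem slidePoint_face {j : ℕ} (θ : Fin (i + 1) ↪o Fin (j + 1))
    (x : (G.confResolution n j).NerveSimplex k) (t : stdSimplex ℝ (Fin (k + 1)))
    (s : stdSimplex ℝ (Fin (i + 1))) (τ : I) :
    w.slidePoint (x.map (G.confFace n θ)) t s τ = w.slidePoint x t (stdSimplex.map θ s) τ := by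
  -- Old points are re-embedded by `θ` and separated points stay fixed; keeping all old points
  -- before all new ones makes this an order embedding.
  let Θ : Fin (i + 1) ⊕ₗ ℕ ↪o Fin (j + 1) ⊕ₗ ℕ :=
    OrderEmbedding.ofMapLEIff (fun a => toLex (Sum.map θ id (ofLex a))) fun a b => by
      obtain ⟨l | a, rfl⟩ := toLex.surjective a <;> obtain ⟨l' | b, rfl⟩ := toLex.surjective b <;>
      simp
  have hm := maxWeight_map s θ.injective
  refine weightedPoint_comp t (w.isWeight_slideWeight x (stdSimplex.map θ s) τ) Θ (fun a ha => ?_)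
    _ (funext fun a => ?_) (funext fun a => ?_)
  · obtain ⟨l | a, rfl⟩ := toLex.surjective a
    · change oldWeight _ _ _ = 0
      rw [oldWeight, map_apply_of_notMem s fun ⟨l', hl'⟩ => ha ⟨toLex (Sum.inl l'), by
        rw [← hl']; rfl⟩]
      have := mul_nonneg (mul_nonneg zero_le_two τ.2.1) (maxWeight_pos (stdSimplex.map θ s)).le
      exact max_eq_left (by linarith)
    · exact absurd ⟨toLex (Sum.inr a), rfl⟩ ha
  · obtain ⟨l | a, rfl⟩ := toLex.surjective a <;> rfl
  · obtain ⟨l | a, rfl⟩ := toLex.surjective a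
    · change oldWeight s τ l = oldWeight (stdSimplex.map θ s) τ (θ l)
      rw [oldWeight, oldWeight, hm, map_apply_of_injective θ.injective]
    · change w.newWeight (x.map (G.confFace n θ)) s τ a = w.newWeight x (stdSimplex.map θ s) τ a
      have h1 : w.clearance (x.map (G.confFace n θ)) s τ a =
          w.clearance x (stdSimplex.map θ s) τ a := by
        refine Fintype.prod_of_injective θ θ.injective _ _ (fun l hl => ?_) fun l => ?_
        · have := τ.2.2
          -- A vertex outside the face has weight zero, and its clearance factor is `1` because the
          -- bump function and `4 τ - 3` are at most `1`.
          rw [map_apply_of_notMem s hl, mul_zero, zero_div, sub_zero,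
            max_eq_left (a := (1 : ℝ)) (by linarith), max_eq_right (w.bump_le_one _ _)]
        · rw [hm, map_apply_of_injective θ.injective]
          rfl
      rw [newWeight, newWeight, h1, hm]
      rfl

end SeparatedPoints

end TopGroupoid

theorem continuous_sigma_prod {ι : Type*} {P : ι → Type*} {Y T : Type*}
    [∀ i, TopologicalSpace (P i)] [TopologicalSpace Y] [TopologicalSpace T]
    {g : (Σ i, P i) × Y → T} (h : ∀ i, Continuous fun p : P i × Y => g (⟨i, p.1⟩, p.2)) :
    Continuous g :=
  Homeomorph.sigmaProdDistrib.symm.comp_continuous_iff'.1 (continuous_sigma h)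

namespace TopGroupoid.SeparatedPoints

open scoped unitInterval

variable {G : TopGroupoid.{u}} {n : ℕ} [T2Space G.Ob] (w : G.SeparatedPoints)

/-! ### The augmentation is a weak homotopy equivalence -/

variable (n) in
/-- A section of the augmentation. -/
noncomputable def sectionMap (hL : IsClosed (Set.ofPred fun p : G.Ob × G.Ob => G.Linked p.1 p.2)) :
    C(G.ConfSpace n, G.Resolution n) :=
  ⟨Quot.lift (fun p => w.sectionPoint p.2.1 p.2.2) (by
      rintro _ _ ⟨θ, y, t⟩
      exact w.sectionPoint_reindex θ.toOrderHom y t),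
    continuous_quot_lift _ (continuous_sigma fun _ => w.continuous_sectionPoint hL)⟩

/-- The homotopy on the product of a classifying space with a simplex. -/
noncomputable def slideLevel {i : ℕ} (s : stdSimplex ℝ (Fin (i + 1))) (τ : I) :
    Quot (RealizationRel (nerve.obj (G.confResolution n i))) → G.Resolution n :=
  Quot.lift (fun p => w.slidePoint p.2.1 p.2.2 s τ) (by
    rintro _ _ ⟨θ, y, t⟩
    exact w.slidePoint_reindex θ.toOrderHom y t s τ)

theorem slideLevel_face {i j : ℕ} (θ : ⦋i⦌ₛ ⟶ ⦋j⦌ₛ)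
    (y : Quot (RealizationRel (nerve.obj (G.confResolution n j))))
    (s : stdSimplex ℝ (Fin (i + 1))) (τ : I) :
    w.slideLevel s τ ((G.classifyingConfSemisimplicial n).map θ.op y) =
      w.slideLevel (stdSimplex.map (SemiSimplexCategory.homEquiv θ) s) τ y := by
  obtain ⟨⟨k, x, t⟩, rfl⟩ := Quot.exists_rep y
  exact w.slidePoint_face (SemiSimplexCategory.homEquiv θ) x t s τ

variable (n) in
/-- The homotopy from the identity of the resolution to the section. -/
noncomputable def slide (τ : I) : G.Resolution n → G.Resolution n :=
  Quot.lift (fun p => w.slideLevel p.2.2 τ p.2.1) (by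
    rintro _ _ ⟨θ, y, s⟩
    exact w.slideLevel_face θ y s τ)

/-- Both realisations are quotients, and a quotient map stays one after taking the product with a
locally compact space. This is applied with `I` for the outer realisation and with a simplex times
`I` for the inner one. -/
theorem continuous_slide
    (hL : IsClosed (Set.ofPred fun p : G.Ob × G.Ob => G.Linked p.1 p.2)) :
    Continuous fun p : G.Resolution n × I => w.slide n p.2 p.1 := by
  refine isQuotientMap_quot_mk.continuous_lift_prod_left ?_
  refine continuous_sigma_prod fun i => ?_
  have h : Continuous fun p : Quot (RealizationRel (nerve.obj (G.confResolution n i))) ×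
      (stdSimplex ℝ (Fin (i + 1)) × I) => w.slideLevel p.2.1 p.2.2 p.1 := by
    refine isQuotientMap_quot_mk.continuous_lift_prod_left ?_
    refine continuous_sigma_prod fun k => ?_
    have hf : Continuous fun p : ((G.confResolution n i).NerveSimplex k ×
        stdSimplex ℝ (Fin (k + 1))) × (stdSimplex ℝ (Fin (i + 1)) × I) =>
          (((p.1.1, p.1.2, p.2.1), p.2.2) : SlideParam n k i G) := by
      fun_prop
    have h3 := (w.continuous_slidePoint hL).comp hf
    have h4 : Continuous fun p : ((G.confResolution n i).NerveSimplex k ×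
        stdSimplex ℝ (Fin (k + 1))) × (stdSimplex ℝ (Fin (i + 1)) × I) =>
          w.slidePoint p.1.1 p.1.2 p.2.1 p.2.2 := h3
    exact h4
  have h' : Continuous fun p : (Quot (RealizationRel (nerve.obj (G.confResolution n i))) ×
      stdSimplex ℝ (Fin (i + 1))) × I => w.slideLevel p.1.2 p.2 p.1.1 := by
    have hf : Continuous fun p : (Quot (RealizationRel (nerve.obj (G.confResolution n i))) ×
        stdSimplex ℝ (Fin (i + 1))) × I => (p.1.1, (p.1.2, p.2)) := by fun_prop
    have h3 := h.comp hf
    exact h3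
  exact h'

theorem exists_eq_resMk' (e : G.Resolution n) :
    ∃ (i k : ℕ) (x : (G.confResolution n i).NerveSimplex k) (t : stdSimplex ℝ (Fin (k + 1)))
      (s : stdSimplex ℝ (Fin (i + 1))), resMk' x t s = e := by
  obtain ⟨⟨i, y, s⟩, rfl⟩ := Quot.exists_rep e
  obtain ⟨⟨k, x, t⟩, rfl⟩ := Quot.exists_rep y
  exact ⟨i, k, x, t, s, rfl⟩

theorem isWeakHomotopyEquiv_confAugmentation (w : G.SeparatedPoints)
    (hL : IsClosed (Set.ofPred fun p : G.Ob × G.Ob => G.Linked p.1 p.2)) :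
    IsWeakHomotopyEquiv (G.confAugmentation n) := by
  have hc : Continuous fun p : I × G.Resolution n => w.slide n p.1 p.2 := by
    have h := (w.continuous_slide (n := n) hL).comp continuous_swap
    exact h
  refine isWeakHomotopyEquiv_of_section (G.confAugmentation n) (w.sectionMap n hL) (fun b => ?_)
    ⟨fun p => w.slide n p.1 p.2, hc⟩ (fun e => ?_) (fun e => ?_) ?_
  · obtain ⟨⟨k, γ, t⟩, rfl⟩ := Quot.exists_rep b
    rfl
  · obtain ⟨i, k, x, t, s, rfl⟩ := exists_eq_resMk' e
    exact w.slidePoint_zero x t s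
  · obtain ⟨i, k, x, t, s, rfl⟩ := exists_eq_resMk' e
    exact w.slidePoint_one x t s
  -- The homotopy alters only the extra chains and their weights; the chain of configurations and
  -- `t` stay fixed, so it lies over the base by definition.
  · rintro ⟨τ, e⟩
    obtain ⟨i, k, x, t, s, rfl⟩ := exists_eq_resMk' e
    rfl

end TopGroupoid.SeparatedPoints

theorem mainTheorem6 {d : ℕ} (hd : 1 ≤ d) (X : Orbifold.{u} d)
    (hX : ∃ x : X.Ob, ¬ X.IsOrbifoldPoint x) (n : ℕ) :
    IsWeakHomotopyEquiv (X.confAugmentation n) := by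
  obtain ⟨w⟩ := X.nonempty_separatedPoints hd hX
  exact w.isWeakHomotopyEquiv_confAugmentation X.isClosed_linked
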